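/- **Setting.** $M$ single-antenna access points (APs), connected to a CPU, serve $K$ single-antenna users with the help of a reconfigurable intelligent surface (RIS) with $N$ elements and phase-shift matrix $\Phi=\mathrm{diag}(e^{j\theta_1},\dots,e^{j\theta_N})$. In every coherence interval of $\tau_c$ symbols, the direct channels $g_{mk}\sim\mathcal{CN}(0,\beta_{mk})$, the AP–RIS channels $h_m\sim\mathcal{CN}(0,R_m)$ and the RIS–user channels $z_k\sim\mathcal{CN}(0,\widetilde R_k)$ are independent, where $\beta_{mk}\ge 0$ and $R_m,\widetilde R_k\in\mathbb C^{N\times N}$ are positive semidefinite. The aggregated channel is $u_{mk}=g_{mk}+h_m^H\Phi z_k$. *Training.* Each user $k$ has a unit-norm pilot $\phi_k\in\mathbb C^{\tau_p}$, $\tau_p<\tau_c$; any two pilots are equal or orthogonal, and $\mathcal P_k$ is the set of users (including $k$) with the pilot of user $k$. AP $m$ receives $y_{pm}=\sqrt{p\tau_p}\sum_{k}u_{mk}\phi_k+w_{pm}$ with $w_{pm}\sim\mathcal{CN}(0,I_{\tau_p})$ and $p\ge0$, forms $y_{pmk}=\phi_k^Hy_{pm}$, and computes the LMMSE estimate $\hat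 u_{mk}=\dfrac{\mathbb E\{y_{pmk}^*u_{mk}\}}{\mathbb E\{|y_{pmk}|^2\}}\,y_{pmk}$. *Data.* A coherence interval carries $n\ge1$ uplink data symbols $s_k[1],\dots,s_k[n]$ of each user $k$. All symbols have zero mean and unit power; the blocks of different users are independent of each other, of the channels and of the noise. AP $m$ receives $y_m[i]=\sqrt\rho\sum_{k'}\sqrt{\eta_{k'}}\,u_{mk'}s_{k'}[i]+w_m[i]$ with $\rho\ge0$, $0\le\eta_{k'}\le1$, and i.i.d. noise $w_m[i]\sim\mathcal{CN}(0,1)$; all noises are independent of each other and of the channels. With maximum-ratio combining (MRC), the CPU forms $r_k[i]=\sum_m\hat u_{mk}^*\,y_m[i]$. The ergodic uplink capacity of user $k$ is $C_k=\frac1n\sup I(s_k[1..n];r_k[1..n])$ bits per data symbol, the supremum being over the laws of the block of user $k$ with zero-mean, unit-power symbols, while the laws of the other users' blocks are given. Its ergodic uplink net throughput is $B\nu(1-\tau_p/\tau_c)\,C_k$, where $B\ge0$ is the bandwidth in MHz and $0\le\nu\le1$ the portion dedicated to uplink data transmission. **Theorem.** For all finite $M$ and $N$, every user $k$, every $n\ge1$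 and all admissible laws of the other users' blocks, the ergodic uplink net throughput of user $k$ is at least $$R_k=B\nu\left(1-\frac{\tau_p}{\tau_c}\right)\log_2(1+\mathrm{SINR}_k)\ \text{[Mbps]},\qquad \mathrm{SINR}_k=\frac{\rho\,\eta_k\left(\sum_{m}\gamma_{mk}\right)^2}{\mathsf{MI}_k+\mathsf{NO}_k},$$ (with $\mathrm{SINR}_k=0$ if $\mathsf{MI}_k+\mathsf{NO}_k=0$, in which case the numerator vanishes too), where $\Theta_{mk}=\Phi^HR_m\Phi\widetilde R_k$, $\delta_{mk}=\beta_{mk}+\mathrm{tr}(\Theta_{mk})$, $$c_{mk}=\frac{\sqrt{p\tau_p}\,\delta_{mk}}{p\tau_p\sum_{k'\in\mathcal P_k}\delta_{mk'}+1},\qquad \gamma_{mk}=\sqrt{p\tau_p}\,\delta_{mk}c_{mk},\qquad \mathsf{NO}_k=\sum_m\gamma_{mk},$$ $$\begin{aligned}\mathsf{MI}_k={}&\rho\sum_{k'=1}^K\sum_{m}\eta_{k'}\gamma_{mk}\delta_{mk'}+p\tau_p\rho\sum_{k'\in\mathcal P_k}\sum_m\eta_{k'}c_{mk}^2\,\mathrm{tr}(\Theta_{mk'}^2)\\&+p\tau_p\rho\sum_{k'=1}^K\sum_{k''\in\mathcal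 P_k}\sum_{m}\sum_{m'}\eta_{k'}c_{mk}c_{m'k}\,\mathrm{tr}(\Theta_{mk'}\Theta_{m'k''})+p\tau_p\rho\sum_{k'\in\mathcal P_k\setminus\{k\}}\eta_{k'}\Big(\sum_mc_{mk}\delta_{mk'}\Big)^2.\end{aligned}$$ Moreover, $\mathrm{SINR}_k$ is exactly the use-and-then-forget SINR of MRC: with $X_{kk'}=\sum_m\hat u_{mk}^*u_{mk'}$, all $X_{kk'}$ and all $\sum_m\hat u_{mk}^*w_m[i]$ are square integrable, $\mathbb E\{X_{kk}\}=\sum_m\gamma_{mk}$, $\ \rho\eta_k\mathbb E\{|X_{kk}-\mathbb E X_{kk}|^2\}+\rho\sum_{k'\ne k}\eta_{k'}\mathbb E\{|X_{kk'}|^2\}=\mathsf{MI}_k$ (in particular $\mathsf{MI}_k$ is real), and $\mathbb E\{|\sum_m\hat u_{mk}^*w_m[i]|^2\}=\mathsf{NO}_k$ for every $i$. -/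

import Mathlib

open MeasureTheory ProbabilityTheory Matrix
open scoped ENNReal NNReal ComplexConjugate ComplexOrder

noncomputable section

/-! ### Circularly symmetric complex Gaussian laws -/

/-- The law `CN(0,1)`: independent real and imaginary parts, each `N(0,1/2)`. -/
def stdComplexGaussian : Measure ℂ :=
  ((gaussianReal 0 (1 / 2)).prod (gaussianReal 0 (1 / 2))).map
    (fun x : ℝ × ℝ => (⟨x.1, x.2⟩ : ℂ))

/-- The law `CN(0,β)` on `ℂ`, for a variance `β ≥ 0`. -/
def complexGaussian (β : ℝ) : Measure ℂ :=
  stdComplexGaussian.map (fun x => (Real.sqrt β : ℂ) * x)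

open scoped MatrixOrder in
/-- The law `CN(0,R)` on `ℂ^N`, for a positive semidefinite covariance matrix `R`: the law of
`R^{1/2} x`, where `x` has i.i.d. `CN(0,1)` entries and `R^{1/2}` is the positive square root. -/
def complexGaussianVec {N : ℕ} (R : Matrix (Fin N) (Fin N) ℂ) : Measure (Fin N → ℂ) :=
  (Measure.pi (fun _ : Fin N => stdComplexGaussian)).map (fun x => CFC.sqrt R *ᵥ x)

/-! ### Mutual information -/

/-- Mutual information (in nats) of `X` and `Y`: the Kullback-Leibler divergence of the joint law
from the product of the marginal laws. -/
def mutualInfo {Ω α β : Type*} [MeasurableSpace Ω] [MeasurableSpace α] [MeasurableSpace β]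
    (P : Measure Ω) (X : Ω → α) (Y : Ω → β) : ℝ≥0∞ :=
  InformationTheory.klDiv (P.map (fun ω => (X ω, Y ω))) ((P.map X).prod (P.map Y))

/-! ### The system -/

/-- An RIS-assisted cell-free system with `M` access points, `K` users, `N` scattering elements
and pilot sequences of length `τp`. -/
structure RISSystem (M K N τp : ℕ) where
  /-- large-scale fading coefficients of the direct links -/
  β : Fin M → Fin K → ℝ
  β_nonneg : ∀ m k, 0 ≤ β m k
  /-- covariance matrices of the links between the access points and the RIS -/
  R : Fin M → Matrix (Fin N) (Fin N) ℂ
  R_psd : ∀ m, (R m).PosSemidef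
  /-- covariance matrices of the links between the RIS and the users -/
  Rt : Fin K → Matrix (Fin N) (Fin N) ℂ
  Rt_psd : ∀ k, (Rt k).PosSemidef
  /-- phase shifts of the RIS -/
  θ : Fin N → ℝ
  /-- pilot sequences: of unit norm, and any two of them are either equal or orthogonal -/
  φ : Fin K → Fin τp → ℂ
  φ_unit : ∀ k, star (φ k) ⬝ᵥ φ k = 1
  φ_orth : ∀ k k', φ k' ≠ φ k → star (φ k') ⬝ᵥ φ k = 0
  /-- normalized SNR of a pilot symbol -/
  p : ℝ
  p_nonneg : 0 ≤ p
  /-- normalized SNR of a data symbol -/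
  ρ : ℝ
  ρ_nonneg : 0 ≤ ρ
  /-- power control coefficients -/
  η : Fin K → ℝ
  η_nonneg : ∀ k, 0 ≤ η k
  η_le_one : ∀ k, η k ≤ 1

/-- The randomness of one coherence interval that carries `n` uplink data symbols: direct
channels, AP-RIS channels, RIS-user channels, pilot noise, data noise. -/
abbrev ChannelSample (M K N τp n : ℕ) : Type :=
  (Fin M → Fin K → ℂ) × (Fin M → Fin N → ℂ) × (Fin K → Fin N → ℂ) ×
    (Fin M → Fin τp → ℂ) × (Fin M → Fin n → ℂ)

namespace RISSystem

variable {M K N τp n : ℕ} (S : RISSystem M K N τp)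

/-- The phase-shift matrix `Φ = diag(e^{jθ_1}, …, e^{jθ_N})`. -/
def Φ : Matrix (Fin N) (Fin N) ℂ :=
  Matrix.diagonal (fun i => Complex.exp (Complex.I * (S.θ i : ℂ)))

open Classical in
/-- The set `P_k` of users (including `k`) that use the pilot sequence of user `k`. -/
def pilotSet (k : Fin K) : Finset (Fin K) :=
  Finset.univ.filter (fun k' => S.φ k' = S.φ k)

/-- Joint law of channels and noise, all independent:
`g_{mk} ~ CN(0,β_{mk})`, `h_m ~ CN(0,R_m)`, `z_k ~ CN(0,R̃_k)`, and unit-variance noise. -/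
def channelLaw (n : ℕ) : Measure (ChannelSample M K N τp n) :=
  (Measure.pi fun m => Measure.pi fun k => complexGaussian (S.β m k)).prod <|
  (Measure.pi fun m => complexGaussianVec (S.R m)).prod <|
  (Measure.pi fun k => complexGaussianVec (S.Rt k)).prod <|
  (Measure.pi fun _ => Measure.pi fun _ => stdComplexGaussian).prod
  (Measure.pi fun _ => Measure.pi fun _ => stdComplexGaussian)

/-- The aggregated channel `u_{mk} = g_{mk} + h_m^H Φ z_k`. -/
def u (m : Fin M) (k : Fin K) (ω : ChannelSample M K N τp n) : ℂ :=
  ω.1 m k + star (ω.2.1 m) ⬝ᵥ (S.Φ *ᵥ ω.2.2.1 k)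

/-- The training signal received at access point `m`. -/
def pilotSignal (m : Fin M) (ω : ChannelSample M K N τp n) : Fin τp → ℂ :=
  (∑ k, ((Real.sqrt (S.p * τp) : ℂ) * S.u m k ω) • S.φ k) + ω.2.2.2.1 m

/-- The training signal projected on the pilot of user `k`. -/
def y (m : Fin M) (k : Fin K) (ω : ChannelSample M K N τp n) : ℂ :=
  star (S.φ k) ⬝ᵥ S.pilotSignal m ω

/-- The LMMSE estimate of `u_{mk}` from `y_{mk}`:
`û_{mk} = (E{y_{mk}^* u_{mk}} / E{|y_{mk}|²}) y_{mk}`. -/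
def uHat (m : Fin M) (k : Fin K) (ω : ChannelSample M K N τp n) : ℂ :=
  (∫ ω', conj (S.y m k ω') * S.u m k ω' ∂(S.channelLaw n)) /
    ((∫ ω', ‖S.y m k ω'‖ ^ 2 ∂(S.channelLaw n) : ℝ) : ℂ) * S.y m k ω

/-- The data signal received at access point `m` in the `i`-th data symbol, when user `k'`
transmits the block `s k'`. -/
def dataSignal (m : Fin M) (i : Fin n) (ω : ChannelSample M K N τp n)
    (s : Fin K → Fin n → ℂ) : ℂ :=
  (Real.sqrt S.ρ : ℂ) * ∑ k', (Real.sqrt (S.η k') : ℂ) * S.u m k' ω * s k' i + ω.2.2.2.2 m i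

/-- The decision statistic `r_k` of maximum-ratio combining, for the `i`-th data symbol. -/
def decision (k : Fin K) (ω : ChannelSample M K N τp n) (s : Fin K → Fin n → ℂ) (i : Fin n) : ℂ :=
  ∑ m, conj (S.uHat m k ω) * S.dataSignal m i ω s

/-! ### Ergodic uplink capacity -/

/-- Admissible law of a block of data symbols of one user: every symbol has zero mean and
unit power. -/
def _root_.AdmissibleSymbols (μ : Measure (Fin n → ℂ)) : Prop :=
  IsProbabilityMeasure μ ∧
    ∀ i, MemLp (fun s => s i) 2 μ ∧ ∫ s, s i ∂μ = 0 ∧ ∫ s, ‖s i‖ ^ 2 ∂μ = 1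

/-- Information (in nats) about the data block of user `k` in the block of decision statistics
`r_k`, when the users transmit independent blocks with laws `Q`, independent of the channels. -/
def blockInfo (k : Fin K) (Q : Fin K → Measure (Fin n → ℂ)) : ℝ≥0∞ :=
  mutualInfo ((S.channelLaw n).prod (Measure.pi Q))
    (fun x => x.2 k) (fun x => S.decision k x.1 x.2)

/-- Ergodic uplink capacity of user `k`, in bits per data symbol, of the channel from its data to
`r_k`, independent from one coherence interval to the next; the other users transmit blocks with
laws `Q k'`, and the law of user `k` is optimized. The receiver knows only the statistics of the
channels. -/
def ergodicCapacity (k : Fin K) (Q : Fin K → Measure (Fin n → ℂ)) : ℝ≥0∞ :=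
  (⨆ (μ : Measure (Fin n → ℂ)) (_ : AdmissibleSymbols μ), S.blockInfo k (Function.update Q k μ)) /
    ((n : ℝ≥0∞) * ENNReal.ofReal (Real.log 2))

/-- Ergodic uplink net throughput: capacity per data symbol, times the bandwidth `B`, the portion
`ν` of the data phase used for the uplink, and the share `1 - τp/τc` that is not spent on pilots.
For `n = ν (τc - τp)` data symbols this is `B/τc` times the capacity of a coherence interval. -/
def ergodicNetThroughput (B ν : ℝ) (τc : ℕ) (k : Fin K) (Q : Fin K → Measure (Fin n → ℂ)) :
    ℝ≥0∞ :=
  ENNReal.ofReal (B * ν * (1 - (τp : ℝ) / τc)) * S.ergodicCapacity k Q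

/-! ### Effective gains and powers in `r_k` -/

/-- The gain `∑_m û_{mk}^* u_{mk'}` with which the symbol of user `k'` enters `r_k` (up to
`√(ρ η_{k'})`). -/
def gain (k k' : Fin K) (ω : ChannelSample M K N τp n) : ℂ :=
  ∑ m, conj (S.uHat m k ω) * S.u m k' ω

/-- The noise in `r_k` in the `i`-th data symbol. -/
def combinedNoise (k : Fin K) (i : Fin n) (ω : ChannelSample M K N τp n) : ℂ :=
  ∑ m, conj (S.uHat m k ω) * ω.2.2.2.2 m i

/-- The mean gain of user `k`. -/
def meanGain (n : ℕ) (k : Fin K) : ℂ :=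
  ∫ ω, S.gain (n := n) k k ω ∂(S.channelLaw n)

/-- Power of the fluctuation of the gain of user `k` plus that of the other users' signals. -/
def interferencePower (n : ℕ) (k : Fin K) : ℝ :=
  S.ρ * S.η k * (∫ ω, ‖S.gain (n := n) k k ω - S.meanGain n k‖ ^ 2 ∂(S.channelLaw n)) +
    S.ρ * ∑ k' ∈ Finset.univ.erase k,
      S.η k' * ∫ ω, ‖S.gain (n := n) k k' ω‖ ^ 2 ∂(S.channelLaw n)

/-- Power of the noise in `r_k`. -/
def noisePower (k : Fin K) (i : Fin n) : ℝ :=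
  ∫ ω, ‖S.combinedNoise k i ω‖ ^ 2 ∂(S.channelLaw n)

/-! ### Closed forms -/

/-- `Θ_{mk} = Φ^H R_m Φ R̃_k`. -/
def Θ (m : Fin M) (k : Fin K) : Matrix (Fin N) (Fin N) ℂ :=
  S.Φᴴ * S.R m * S.Φ * S.Rt k

/-- `δ_{mk} = β_{mk} + tr(Θ_{mk})`; this trace is real, as `Θ_{mk}` is a product of two
positive semidefinite matrices. -/
def δ (m : Fin M) (k : Fin K) : ℝ :=
  S.β m k + (S.Θ m k).trace.re

/-- The coefficient `c_{mk}`. -/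
def c (m : Fin M) (k : Fin K) : ℝ :=
  Real.sqrt (S.p * τp) * S.δ m k / (S.p * τp * (∑ k' ∈ S.pilotSet k, S.δ m k') + 1)

/-- The variance `γ_{mk}` of the channel estimate. -/
def γ (m : Fin M) (k : Fin K) : ℝ :=
  Real.sqrt (S.p * τp) * S.δ m k * S.c m k

/-- The mutual interference `MI_k`, written over `ℂ` because the individual traces in the third
term need not be real. -/
def MI (k : Fin K) : ℂ :=
  (S.ρ : ℂ) * (∑ k', ∑ m, (S.η k' : ℂ) * S.γ m k * S.δ m k')
  + S.p * τp * S.ρ * (∑ k' ∈ S.pilotSet k, ∑ m,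
      (S.η k' : ℂ) * S.c m k ^ 2 * (S.Θ m k' ^ 2).trace)
  + S.p * τp * S.ρ * (∑ k', ∑ k'' ∈ S.pilotSet k, ∑ m, ∑ m',
      (S.η k' : ℂ) * S.c m k * S.c m' k * (S.Θ m k' * S.Θ m' k'').trace)
  + S.p * τp * S.ρ * (∑ k' ∈ (S.pilotSet k).erase k,
      (S.η k' : ℂ) * (∑ m, (S.c m k : ℂ) * S.δ m k') ^ 2)

/-- The noise term `NO_k`. -/
def NO (k : Fin K) : ℝ := ∑ m, S.γ m k

/-- The effective SINR of user `k`. -/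
def SINR (k : Fin K) : ℝ :=
  S.ρ * S.η k * (∑ m, S.γ m k) ^ 2 / ((S.MI k).re + S.NO k)

/-- The closed-form throughput bound `R_k`. -/
def rate (B ν : ℝ) (τc : ℕ) (k : Fin K) : ℝ :=
  B * ν * (1 - (τp : ℝ) / τc) * Real.logb 2 (1 + S.SINR k)

end RISSystem

end

/-! The rate bound rests on two independent facts: an information inequality that needs only second
moments, and an exact evaluation of those moments.

Information. Give user `k` i.i.d. `CN(0,1)` symbols, and let `a` be the amplitude times the mean
gain and `v` the interference plus noise power. Mutual information is a Kullback-Leibler divergence,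
hence at least the joint mean of any integrable `f` with `∫ exp f = 1` under the product of the
marginals (`ofReal_integral_le_klDiv`). Take for `f` the sum over the symbols of the log-likelihood
ratio of the Gaussian test channel `r = a s + noise` of noise power `v`. Averaging `exp f` over the
Gaussian input gives `1` for each fixed output, so the true output law is irrelevant. The joint mean
of `f` depends only on `E|r|² = a² + v` and `E|r - a s|² = v`, and equals `n log(1 + a²/v)`
(`ofReal_log_le_mutualInfo`). These two identities hold because noise and symbols enter `r` with
coefficients independent of an orthonormal family: the constant `1` and the symbols of the users
(`integral_norm_sq_sum_mul_of_orthonormal`).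

Moments. The LMMSE estimate is `c_{mk} y_{mk}`. Once the RIS-user channels `z` are fixed, `u`, `y`
and the data noise are linear forms in i.i.d. `CN(0,1)` variables, so Wick's formula
(`integral_wick_dotProduct`) turns fourth moments into products of conditional covariances. These
are constants plus quadratic forms in the Gaussian vector behind `z`, and `E[z^H P z · z^H Q z] = tr
P tr Q + tr(PQ)` (`integral_quadraticForm_mul`) averages them out. The vectors `z` are common to all
access points, so `tr(PQ)` also survives for `m ≠ m'`; this produces the double sum over access
points in `MI`. The results are `integral_fourthMoment`, `noisePower_eq` and
`interferencePower_eq_MI`. -/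

/-- All absolute moments of `f` are finite. -/
def FiniteMoments {Ω E : Type*} [MeasurableSpace Ω] [NormedAddCommGroup E] (f : Ω → E)
    (μ : Measure Ω) : Prop :=
  ∀ p : ℝ≥0∞, p ≠ ∞ → MemLp f p μ

/-! ### Closure properties of functions with finite moments -/

namespace FiniteMoments

variable {Ω Ω' : Type*} [MeasurableSpace Ω] [MeasurableSpace Ω'] {μ : Measure Ω} {ν : Measure Ω'}
  {f g : Ω → ℂ}

lemma memLp_two {f : Ω → ℂ} (hf : FiniteMoments f μ) : MemLp f 2 μ := hf 2 (by simp)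

lemma integrable {f : Ω → ℂ} (hf : FiniteMoments f μ) : Integrable f μ :=
  memLp_one_iff_integrable.1 (hf 1 (by simp))

lemma const [IsFiniteMeasure μ] (c : ℂ) : FiniteMoments (fun _ : Ω => c) μ :=
  fun _ _ => memLp_const c

lemma add (hf : FiniteMoments f μ) (hg : FiniteMoments g μ) :
    FiniteMoments (fun x => f x + g x) μ := fun p hp => (hf p hp).add (hg p hp)

lemma mul (hf : FiniteMoments f μ) (hg : FiniteMoments g μ) :
    FiniteMoments (fun x => f x * g x) μ := by
  intro p hp
  have h2 : (2 : ℝ≥0∞) * p ≠ ∞ := ENNReal.mul_ne_top (by simp) hp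
  -- Hölder's inequality with `1/(2p) + 1/(2p) = 1/p`. The doubled exponent is why all finite
  -- exponents are required at once: the class is then closed under products.
  have : ENNReal.HolderTriple (2 * p) (2 * p) p := by
    constructor
    rw [ENNReal.mul_inv (by simp) (by simp), ← add_mul, ENNReal.inv_two_add_inv_two, one_mul]
  exact MemLp.mul' (hg _ h2) (hf _ h2)

lemma const_mul (c : ℂ) (hf : FiniteMoments f μ) : FiniteMoments (fun x => c * f x) μ :=
  fun p hp => (hf p hp).const_mul c

lemma conjugate (hf : FiniteMoments f μ) : FiniteMoments (fun x => (starRingEnd ℂ) (f x)) μ :=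
  fun p hp => (hf p hp).star

lemma sum {ι : Type*} (s : Finset ι) {F : ι → Ω → ℂ} (hF : ∀ i ∈ s, FiniteMoments (F i) μ) :
    FiniteMoments (fun x => ∑ i ∈ s, F i x) μ :=
  fun p hp => memLp_finsetSum s fun i hi => hF i hi p hp

lemma comp {f : Ω' → ℂ} (hf : FiniteMoments f ν) {T : Ω → Ω'} (hT : MeasurePreserving T μ ν) :
    FiniteMoments (fun x => f (T x)) μ :=
  fun p hp => (hf p hp).comp_measurePreserving hT

lemma dotProduct {ι : Type*} [Fintype ι] {F G : Ω → ι → ℂ}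
    (hF : ∀ i, FiniteMoments (fun x => F x i) μ) (hG : ∀ i, FiniteMoments (fun x => G x i) μ) :
    FiniteMoments (fun x => F x ⬝ᵥ G x) μ :=
  sum _ fun i _ => (hF i).mul (hG i)

end FiniteMoments

/-! ### Moments of the standard complex Gaussian law -/

lemma integral_pow_one_gaussianReal_zero (v : ℝ≥0) : ∫ x, x ∂(gaussianReal 0 v) = 0 := by simp

lemma integral_pow_two_gaussianReal_zero (v : ℝ≥0) : ∫ x, x ^ 2 ∂(gaussianReal 0 v) = v := by
  have h := variance_of_integral_eq_zero (X := fun x : ℝ => x) (μ := gaussianReal 0 v)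
    measurable_id.aemeasurable (by simp)
  rw [variance_fun_id_gaussianReal] at h
  exact h.symm

lemma integrable_pow_gaussianReal (v : ℝ≥0) (n : ℕ) :
    Integrable (fun x : ℝ => x ^ n) (gaussianReal 0 v) := by
  have h := (memLp_id_gaussianReal' (μ := 0) (v := v) (n : ℝ≥0∞) (by simp)).integrable_norm_pow'
  refine (integrable_norm_iff (by fun_prop)).1 ?_
  simpa using h

/-- For independent copies `X`, `Y`, the sum `X + Y` has the law of `√2 X`. Hence `4 E X⁴ = E (X +
Y)⁴ = 2 E X⁴ + 6 v²`, the odd terms vanishing because the mean is zero. -/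
lemma integral_pow_four_gaussianReal_zero (v : ℝ≥0) :
    ∫ x, x ^ 4 ∂(gaussianReal 0 v) = 3 * v ^ 2 := by
  set N := gaussianReal 0 v with hN
  have h1 : (N.prod N).map (fun z : ℝ × ℝ => z.1 + z.2) = gaussianReal 0 (v + v) := by
    have := gaussianReal_conv_gaussianReal (m₁ := 0) (m₂ := 0) (v₁ := v) (v₂ := v)
    rw [add_zero] at this
    exact this
  have h2 : N.map (fun x => Real.sqrt 2 * x) = gaussianReal 0 (v + v) := by
    rw [hN, gaussianReal_map_const_mul]
    congr 1
    · simp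
    · ext
      push_cast
      rw [Real.sq_sqrt (by norm_num)]
      ring
  have i := integrable_pow_gaussianReal v
  have e : ∫ z, (z.1 + z.2) ^ 4 ∂(N.prod N) = 4 * ∫ x, x ^ 4 ∂N := by
    rw [← integral_map (φ := fun z : ℝ × ℝ => z.1 + z.2) (f := fun x : ℝ => x ^ 4)
      (by fun_prop) (by fun_prop), h1, ← h2,
      integral_map (by fun_prop) (by fun_prop), ← integral_const_mul]
    congr 1 with x
    rw [mul_pow, show (4 : ℕ) = 2 * 2 from rfl, pow_mul (Real.sqrt 2), Real.sq_sqrt (by norm_num)]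
    norm_num
  have e2 : ∀ a b : ℕ, ∫ z, z.1 ^ a * z.2 ^ b ∂(N.prod N) = (∫ x, x ^ a ∂N) * ∫ x, x ^ b ∂N :=
    fun a b => integral_prod_mul (fun x : ℝ => x ^ a) (fun x : ℝ => x ^ b)
  have i2 : ∀ a b : ℕ, Integrable (fun z : ℝ × ℝ => z.1 ^ a * z.2 ^ b) (N.prod N) :=
    fun a b => (i a).mul_prod (i b)
  have e3 : ∫ z, (z.1 + z.2) ^ 4 ∂(N.prod N) = ∫ z, (z.1 ^ 4 * z.2 ^ 0 + 4 * (z.1 ^ 3 * z.2 ^ 1)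
      + 6 * (z.1 ^ 2 * z.2 ^ 2) + 4 * (z.1 ^ 1 * z.2 ^ 3) + z.1 ^ 0 * z.2 ^ 4) ∂(N.prod N) := by
    congr 1 with z
    ring
  have j1 := i2 4 0
  have j2 := (i2 3 1).const_mul 4
  have j3 := (i2 2 2).const_mul 6
  have j4 := (i2 1 3).const_mul 4
  rw [integral_add (((j1.fun_add j2).fun_add j3).fun_add j4) (i2 0 4),
    integral_add ((j1.fun_add j2).fun_add j3) j4, integral_add (j1.fun_add j2) j3, integral_add j1 j2,
    integral_const_mul, integral_const_mul, integral_const_mul, e2, e2, e2, e2, e2] at e3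
  simp only [pow_one, integral_pow_one_gaussianReal_zero, hN,
    integral_pow_two_gaussianReal_zero] at e3 e
  simp at e3
  rw [e] at e3
  linarith

lemma continuous_complex_mk : Continuous (fun x : ℝ × ℝ => (⟨x.1, x.2⟩ : ℂ)) :=
  Complex.equivRealProdCLM.symm.continuous

instance : IsProbabilityMeasure stdComplexGaussian :=
  Measure.isProbabilityMeasure_map continuous_complex_mk.aemeasurable

lemma finiteMoments_id_stdComplexGaussian : FiniteMoments (fun x : ℂ => x) stdComplexGaussian := by
  intro p hp
  refine (memLp_map_measure_iff (by fun_prop) continuous_complex_mk.aemeasurable).2 ?_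
  have h := memLp_id_gaussianReal' (μ := 0) (v := 1 / 2) p hp
  have h1 : MemLp (fun z : ℝ × ℝ => (z.1 : ℂ)) p
      ((gaussianReal 0 (1 / 2)).prod (gaussianReal 0 (1 / 2))) := (h.comp_fst _).ofReal
  have h2 : MemLp (fun z : ℝ × ℝ => (z.2 : ℂ)) p
      ((gaussianReal 0 (1 / 2)).prod (gaussianReal 0 (1 / 2))) :=
    (h.comp_snd (gaussianReal 0 (1 / 2))).ofReal
  convert h1.add (h2.const_mul Complex.I) using 1
  ext z
  simp [Complex.ext_iff]

lemma stdComplexGaussian_map_conj :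
    stdComplexGaussian.map (fun x => conj x) = stdComplexGaussian := by
  have h : MeasurePreserving (fun z : ℝ × ℝ => (z.1, -z.2))
      ((gaussianReal 0 (1 / 2)).prod (gaussianReal 0 (1 / 2)))
      ((gaussianReal 0 (1 / 2)).prod (gaussianReal 0 (1 / 2))) :=
    (MeasurePreserving.id _).prod (g := fun x : ℝ => -x) ⟨measurable_neg, by rw [gaussianReal_map_neg, neg_zero]⟩
  unfold stdComplexGaussian
  rw [Measure.map_map Complex.continuous_conj.measurable continuous_complex_mk.measurable]
  nth_rewrite 2 [← h.map_eq]
  rw [Measure.map_map continuous_complex_mk.measurable h.measurable]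
  congr 1

/-- A quarter turn swaps the two i.i.d. coordinates and negates one of them. This much circular
symmetry is enough to kill the unbalanced moments of low order. -/
lemma stdComplexGaussian_map_I_mul :
    stdComplexGaussian.map (fun x => Complex.I * x) = stdComplexGaussian := by
  have h : MeasurePreserving (fun z : ℝ × ℝ => (-z.2, z.1))
      ((gaussianReal 0 (1 / 2)).prod (gaussianReal 0 (1 / 2)))
      ((gaussianReal 0 (1 / 2)).prod (gaussianReal 0 (1 / 2))) :=
    (MeasurePreserving.prod (f := fun x : ℝ => -x) ⟨measurable_neg, by rw [gaussianReal_map_neg, neg_zero]⟩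
      (MeasurePreserving.id _)).comp Measure.measurePreserving_swap
  unfold stdComplexGaussian
  rw [Measure.map_map (by fun_prop) continuous_complex_mk.measurable]
  nth_rewrite 2 [← h.map_eq]
  rw [Measure.map_map continuous_complex_mk.measurable h.measurable]
  refine congrArg (fun f => Measure.map f _) (funext fun z => ?_)
  apply Complex.ext <;> simp

lemma integral_norm_sq_stdComplexGaussian : ∫ x, ‖x‖ ^ 2 ∂stdComplexGaussian = 1 := by
  rw [stdComplexGaussian, integral_map continuous_complex_mk.aemeasurable (by fun_prop)]
  set N := gaussianReal 0 (1 / 2) with hN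
  have i := integrable_pow_gaussianReal (1 / 2)
  have e : (fun z : ℝ × ℝ => ‖(⟨z.1, z.2⟩ : ℂ)‖ ^ 2) =
      fun z => z.1 ^ 2 * z.2 ^ 0 + z.1 ^ 0 * z.2 ^ 2 := by
    ext z
    rw [Complex.sq_norm, Complex.normSq_mk]
    ring
  rw [e, integral_add ((i 2).mul_prod (i 0)) ((i 0).mul_prod (i 2)),
    integral_prod_mul (fun x : ℝ => x ^ 2) (fun x : ℝ => x ^ 0),
    integral_prod_mul (fun x : ℝ => x ^ 0) (fun x : ℝ => x ^ 2)]
  simp only [integral_pow_two_gaussianReal_zero]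
  simp
  norm_num

lemma integral_norm_pow_four_stdComplexGaussian : ∫ x, ‖x‖ ^ 4 ∂stdComplexGaussian = 2 := by
  rw [stdComplexGaussian, integral_map continuous_complex_mk.aemeasurable (by fun_prop)]
  set N := gaussianReal 0 (1 / 2) with hN
  have i := integrable_pow_gaussianReal (1 / 2)
  have e : (fun z : ℝ × ℝ => ‖(⟨z.1, z.2⟩ : ℂ)‖ ^ 4) =
      fun z => z.1 ^ 4 * z.2 ^ 0 + 2 * (z.1 ^ 2 * z.2 ^ 2) + z.1 ^ 0 * z.2 ^ 4 := by
    ext z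
    rw [show (4 : ℕ) = 2 * 2 from rfl, pow_mul, Complex.sq_norm, Complex.normSq_mk]
    ring
  have j := ((i 2).mul_prod (i 2)).const_mul 2
  rw [e, integral_add (((i 4).mul_prod (i 0)).fun_add j) ((i 0).mul_prod (i 4)),
    integral_add ((i 4).mul_prod (i 0)) j, integral_const_mul,
    integral_prod_mul (fun x : ℝ => x ^ 4) (fun x : ℝ => x ^ 0),
    integral_prod_mul (fun x : ℝ => x ^ 2) (fun x : ℝ => x ^ 2),
    integral_prod_mul (fun x : ℝ => x ^ 0) (fun x : ℝ => x ^ 4)]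
  simp only [integral_pow_two_gaussianReal_zero, integral_pow_four_gaussianReal_zero]
  simp
  norm_num

/-- Mixed moments of `CN(0,1)`, of orders at most two in the variable and in its conjugate. -/
lemma integral_conj_pow_mul_pow_stdComplexGaussian {p q : ℕ} (hp : p ≤ 2) (hq : q ≤ 2) :
    ∫ x, conj x ^ p * x ^ q ∂stdComplexGaussian = if p = q then (p.factorial : ℂ) else 0 := by
  -- Invariance under `x ↦ I x` multiplies the moment by `I^(q - p)`, which differs from `1`
  -- whenever `0 < |q - p| ≤ 2`; so those moments vanish.
  have rot : ∫ x, conj x ^ p * x ^ q ∂stdComplexGaussian =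
      conj Complex.I ^ p * Complex.I ^ q * ∫ x, conj x ^ p * x ^ q ∂stdComplexGaussian := by
    conv_lhs => rw [← stdComplexGaussian_map_I_mul]
    rw [integral_map (by fun_prop) (by fun_prop), ← integral_const_mul]
    congr 1 with x
    simp only [map_mul]
    ring
  have h2 : ∫ x, conj x ^ 1 * x ^ 1 ∂stdComplexGaussian = 1 := by
    have : ∀ x : ℂ, conj x ^ 1 * x ^ 1 = ((‖x‖ ^ 2 : ℝ) : ℂ) := fun x => by
      rw [pow_one, pow_one, Complex.conj_mul']
      simp
    simp_rw [this]
    rw [integral_complex_ofReal, integral_norm_sq_stdComplexGaussian, Complex.ofReal_one]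
  have h4 : ∫ x, conj x ^ 2 * x ^ 2 ∂stdComplexGaussian = 2 := by
    have : ∀ x : ℂ, conj x ^ 2 * x ^ 2 = ((‖x‖ ^ 4 : ℝ) : ℂ) := fun x => by
      rw [← mul_pow, Complex.conj_mul']
      push_cast
      ring
    simp_rw [this]
    rw [integral_complex_ofReal, integral_norm_pow_four_stdComplexGaussian]
    simp
  interval_cases p <;> interval_cases q
  · simp
  · simp [Complex.ext_iff] at rot ⊢; constructor <;> linarith
  · simp [Complex.ext_iff] at rot ⊢; constructor <;> linarith
  · simp [Complex.ext_iff] at rot ⊢; constructor <;> linarith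
  · simpa using h2
  · simp [pow_two, Complex.ext_iff] at rot ⊢; constructor <;> linarith
  · simp [Complex.ext_iff] at rot ⊢; constructor <;> linarith
  · simp [pow_two, Complex.ext_iff] at rot ⊢; constructor <;> linarith
  · simpa using h4

/-! ### Gaussian vectors with independent entries -/

/-- The law of a vector of i.i.d. `CN(0,1)` entries. -/
noncomputable abbrev stdComplexGaussianPi (J : Type*) [Fintype J] : Measure (J → ℂ) :=
  Measure.pi fun _ => stdComplexGaussian

section Wick

variable {J : Type*} [Fintype J]

lemma finiteMoments_eval_stdComplexGaussianPi (j : J) :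
    FiniteMoments (fun x : J → ℂ => x j) (stdComplexGaussianPi J) :=
  finiteMoments_id_stdComplexGaussian.comp (measurePreserving_eval _ j)

lemma finiteMoments_dotProduct_stdComplexGaussianPi (a : J → ℂ) :
    FiniteMoments (fun x : J → ℂ => a ⬝ᵥ x) (stdComplexGaussianPi J) :=
  FiniteMoments.dotProduct (fun _ => FiniteMoments.const _)
    finiteMoments_eval_stdComplexGaussianPi

lemma integral_prod_conj_pow_mul_pow {p q : J → ℕ} (hp : ∀ j, p j ≤ 2) (hq : ∀ j, q j ≤ 2) :
    ∫ x, ∏ j, (conj (x j) ^ p j * x j ^ q j) ∂(stdComplexGaussianPi J) =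
      ∏ j, if p j = q j then ((p j).factorial : ℂ) else 0 := by
  rw [integral_fintype_prod_eq_prod (fun j (x : ℂ) => conj x ^ p j * x ^ q j)]
  exact Finset.prod_congr rfl fun j _ =>
    integral_conj_pow_mul_pow_stdComplexGaussian (hp j) (hq j)

lemma integral_conj_mul_eval [DecidableEq J] (i j : J) :
    ∫ x, conj (x i) * x j ∂(stdComplexGaussianPi J) = if i = j then 1 else 0 := by
  have key := integral_prod_conj_pow_mul_pow (J := J)
    (p := fun q => if q = i then 1 else 0) (q := fun q => if q = j then 1 else 0)
    (fun q => by split_ifs <;> omega) (fun q => by split_ifs <;> omega)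
  have e : ∀ x : J → ℂ, ∏ q, (conj (x q) ^ (if q = i then 1 else 0) *
      x q ^ (if q = j then 1 else 0)) = conj (x i) * x j := by
    intro x
    simp only [Finset.prod_mul_distrib, pow_ite, pow_one, pow_zero, Finset.prod_ite_eq',
      Finset.mem_univ, if_true]
  simp_rw [e] at key
  rw [key]
  by_cases h : i = j
  · subst h
    rw [if_pos rfl]
    refine Finset.prod_eq_one fun q _ => ?_
    split_ifs <;> simp_all
  · rw [if_neg h]
    exact Finset.prod_eq_zero (Finset.mem_univ i) (by simp [h])

/-- Wick's formula for the coordinates. -/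
lemma integral_wick_eval [DecidableEq J] (i j k l : J) :
    ∫ x, conj (x i) * x j * x k * conj (x l) ∂(stdComplexGaussianPi J) =
      (if i = j then 1 else 0) * (if l = k then 1 else 0) +
      (if i = k then 1 else 0) * (if l = j then 1 else 0) := by
  -- The monomial is a product over all coordinates, with exponents counting how often a coordinate
  -- occurs among `i, l` (conjugated) and among `j, k`. No exponent exceeds two.
  have key := integral_prod_conj_pow_mul_pow (J := J)
    (p := fun q => (if q = i then 1 else 0) + (if q = l then 1 else 0))
    (q := fun q => (if q = j then 1 else 0) + (if q = k then 1 else 0))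
    (fun q => by split_ifs <;> omega) (fun q => by split_ifs <;> omega)
  have e : ∀ x : J → ℂ, ∏ q, (conj (x q) ^ ((if q = i then 1 else 0) + (if q = l then 1 else 0)) *
      x q ^ ((if q = j then 1 else 0) + (if q = k then 1 else 0))) =
      conj (x i) * x j * x k * conj (x l) := by
    intro x
    simp only [pow_add, Finset.prod_mul_distrib, pow_ite, pow_one, pow_zero,
      Finset.prod_ite_eq', Finset.mem_univ, if_true]
    ring
  simp_rw [e] at key
  rw [key]
  -- The moment is nonzero exactly when `{i, l}` and `{j, k}` agree as multisets.
  by_cases h : (i = j ∧ l = k) ∨ (i = k ∧ l = j)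
  · have hpq : ∀ q, ((if q = i then 1 else 0) + (if q = l then 1 else 0) : ℕ) =
        (if q = j then 1 else 0) + (if q = k then 1 else 0) := by
      intro q
      rcases h with ⟨rfl, rfl⟩ | ⟨rfl, rfl⟩
      · rfl
      · rw [add_comm]
    simp only [hpq, if_true]
    -- If all indices coincide, the factor `2!` accounts for both pairings; otherwise exactly one
    -- pairing holds and every factor is `1`.
    by_cases hjk : j = k
    · subst hjk
      obtain ⟨rfl, rfl⟩ : i = j ∧ l = j := by tauto
      rw [Finset.prod_eq_single l]
      · simp; norm_num
      · intro b _ hb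
        simp [hb]
      · simp
    · rw [Finset.prod_eq_one]
      · rcases h with ⟨rfl, rfl⟩ | ⟨rfl, rfl⟩
        · simp [hjk]
        · simp [hjk]
      · intro q _
        by_cases h1 : q = j
        · have : q ≠ k := fun h2 => hjk (h1.symm.trans h2)
          simp [h1, hjk]
        · by_cases h2 : q = k <;> simp [h1, h2, Ne.symm hjk]
  · have hne : ¬ ∀ q, ((if q = i then 1 else 0) + (if q = l then 1 else 0) : ℕ) =
        (if q = j then 1 else 0) + (if q = k then 1 else 0) := by
      intro hall
      have h1 := hall i
      have h2 := hall l
      apply h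
      grind
    push Not at hne
    obtain ⟨q, hq⟩ := hne
    rw [Finset.prod_eq_zero (Finset.mem_univ q) (if_neg hq)]
    grind

lemma integral_conj_dotProduct_mul (a b : J → ℂ) :
    ∫ x, conj (a ⬝ᵥ x) * (b ⬝ᵥ x) ∂(stdComplexGaussianPi J) = star a ⬝ᵥ b := by
  classical
  have hm := finiteMoments_eval_stdComplexGaussianPi (J := J)
  have e : ∀ x : J → ℂ, conj (a ⬝ᵥ x) * (b ⬝ᵥ x) =
      ∑ i, ∑ j, conj (a i) * b j * (conj (x i) * x j) := by
    intro x
    simp only [dotProduct, map_sum, map_mul, Finset.sum_mul_sum]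
    exact Finset.sum_congr rfl fun i _ => Finset.sum_congr rfl fun j _ => by ring
  simp_rw [e]
  have hi : ∀ i j, FiniteMoments (fun x : J → ℂ => conj (a i) * b j * (conj (x i) * x j))
      (stdComplexGaussianPi J) := fun i j => ((hm i).conjugate.mul (hm j)).const_mul _
  rw [integral_finsetSum _ fun i _ => (FiniteMoments.sum _ fun j _ => hi i j).integrable]
  simp_rw [integral_finsetSum _ fun j _ => (hi _ j).integrable, integral_const_mul,
    integral_conj_mul_eval]
  simp [dotProduct]

/-- Wick's formula for linear forms. -/
lemma integral_wick_dotProduct (a b c d : J → ℂ) :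
    ∫ x, conj (a ⬝ᵥ x) * (b ⬝ᵥ x) * (c ⬝ᵥ x) * conj (d ⬝ᵥ x) ∂(stdComplexGaussianPi J) =
      (star a ⬝ᵥ b) * (star d ⬝ᵥ c) + (star a ⬝ᵥ c) * (star d ⬝ᵥ b) := by
  classical
  have hm := finiteMoments_eval_stdComplexGaussianPi (J := J)
  have e : ∀ x : J → ℂ, conj (a ⬝ᵥ x) * (b ⬝ᵥ x) * (c ⬝ᵥ x) * conj (d ⬝ᵥ x) =
      ∑ i, ∑ j, ∑ k, ∑ l, conj (a i) * b j * c k * conj (d l) *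
        (conj (x i) * x j * x k * conj (x l)) := by
    intro x
    simp only [dotProduct, map_sum, map_mul]
    rw [mul_assoc, Finset.sum_mul_sum, Finset.sum_mul_sum]
    simp only [Finset.sum_mul]
    simp only [Finset.mul_sum]
    exact Finset.sum_congr rfl fun i _ => Finset.sum_congr rfl fun j _ =>
      Finset.sum_congr rfl fun k _ => Finset.sum_congr rfl fun l _ => by ring
  have hi : ∀ i j k l, FiniteMoments (fun x : J → ℂ => conj (a i) * b j * c k * conj (d l) *
        (conj (x i) * x j * x k * conj (x l))) (stdComplexGaussianPi J) :=
    fun i j k l => ((((hm i).conjugate.mul (hm j)).mul (hm k)).mul (hm l).conjugate).const_mul _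
  simp_rw [e]
  rw [integral_finsetSum _ fun i _ => (FiniteMoments.sum _ fun j _ => FiniteMoments.sum _ fun k _ =>
    FiniteMoments.sum _ fun l _ => hi i j k l).integrable]
  simp_rw [integral_finsetSum _ fun j _ => (FiniteMoments.sum _ fun k _ =>
    FiniteMoments.sum _ fun l _ => hi _ j k l).integrable,
    integral_finsetSum _ fun k _ => (FiniteMoments.sum _ fun l _ => hi _ _ k l).integrable,
    integral_finsetSum _ fun l _ => (hi _ _ _ l).integrable, integral_const_mul,
    integral_wick_eval, mul_add, Finset.sum_add_distrib]
  congr 1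
  · simp only [dotProduct, Pi.star_apply, Finset.sum_mul_sum]
    refine Finset.sum_congr rfl fun i _ => ?_
    rw [Finset.sum_eq_single i (by intro b _ hb; simp [Ne.symm hb]) (by simp)]
    refine Finset.sum_congr rfl fun k _ => ?_
    rw [Finset.sum_eq_single k (by intro b _ hb; simp [hb]) (by simp)]
    simp only [if_true, mul_one, RCLike.star_def]
    ring
  · simp only [dotProduct, Pi.star_apply, Finset.sum_mul_sum]
    refine Finset.sum_congr rfl fun i _ => ?_
    refine Finset.sum_congr rfl fun j _ => ?_
    rw [Finset.sum_eq_single i (by intro b _ hb; simp [Ne.symm hb]) (by simp)]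
    rw [Finset.sum_eq_single j (by intro b _ hb; simp [hb]) (by simp)]
    simp only [if_true, mul_one, RCLike.star_def]
    ring

lemma finiteMoments_quadraticForm (P : Matrix J J ℂ) :
    FiniteMoments (fun x : J → ℂ => star x ⬝ᵥ P *ᵥ x) (stdComplexGaussianPi J) :=
  FiniteMoments.dotProduct (fun i => (finiteMoments_eval_stdComplexGaussianPi i).conjugate)
    fun i => finiteMoments_dotProduct_stdComplexGaussianPi (P i)

lemma quadraticForm_eq_sum (P : Matrix J J ℂ) (x : J → ℂ) :
    star x ⬝ᵥ P *ᵥ x = ∑ i, ∑ j, P i j * (conj (x i) * x j) := by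
  simp only [dotProduct, mulVec, Finset.mul_sum, Pi.star_apply, RCLike.star_def]
  exact Finset.sum_congr rfl fun i _ => Finset.sum_congr rfl fun j _ => by ring

lemma integral_quadraticForm (P : Matrix J J ℂ) :
    ∫ x, star x ⬝ᵥ P *ᵥ x ∂(stdComplexGaussianPi J) = P.trace := by
  classical
  have hm := finiteMoments_eval_stdComplexGaussianPi (J := J)
  simp_rw [quadraticForm_eq_sum]
  have hi : ∀ i j, FiniteMoments (fun x : J → ℂ => P i j * (conj (x i) * x j))
      (stdComplexGaussianPi J) := fun i j => ((hm i).conjugate.mul (hm j)).const_mul _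
  rw [integral_finsetSum _ fun i _ => (FiniteMoments.sum _ fun j _ => hi i j).integrable]
  simp_rw [integral_finsetSum _ fun j _ => (hi _ j).integrable, integral_const_mul,
    integral_conj_mul_eval]
  simp [trace]

lemma integral_quadraticForm_mul (P Q : Matrix J J ℂ) :
    ∫ x, (star x ⬝ᵥ P *ᵥ x) * (star x ⬝ᵥ Q *ᵥ x) ∂(stdComplexGaussianPi J) =
      P.trace * Q.trace + (P * Q).trace := by
  classical
  have hm := finiteMoments_eval_stdComplexGaussianPi (J := J)
  have e : ∀ x : J → ℂ, (star x ⬝ᵥ P *ᵥ x) * (star x ⬝ᵥ Q *ᵥ x) =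
      ∑ i, ∑ j, ∑ k, ∑ l, P i j * Q k l * (conj (x i) * x j * x l * conj (x k)) := by
    intro x
    rw [quadraticForm_eq_sum, quadraticForm_eq_sum]
    simp only [Finset.sum_mul]
    simp only [Finset.mul_sum]
    exact Finset.sum_congr rfl fun i _ => Finset.sum_congr rfl fun j _ =>
      Finset.sum_congr rfl fun k _ => Finset.sum_congr rfl fun l _ => by ring
  have hi : ∀ i j k l, FiniteMoments (fun x : J → ℂ => P i j * Q k l *
        (conj (x i) * x j * x l * conj (x k))) (stdComplexGaussianPi J) :=
    fun i j k l => ((((hm i).conjugate.mul (hm j)).mul (hm l)).mul (hm k).conjugate).const_mul _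
  simp_rw [e]
  rw [integral_finsetSum _ fun i _ => (FiniteMoments.sum _ fun j _ => FiniteMoments.sum _ fun k _ =>
    FiniteMoments.sum _ fun l _ => hi i j k l).integrable]
  simp_rw [integral_finsetSum _ fun j _ => (FiniteMoments.sum _ fun k _ =>
    FiniteMoments.sum _ fun l _ => hi _ j k l).integrable,
    integral_finsetSum _ fun k _ => (FiniteMoments.sum _ fun l _ => hi _ _ k l).integrable,
    integral_finsetSum _ fun l _ => (hi _ _ _ l).integrable, integral_const_mul,
    integral_wick_eval, mul_add, Finset.sum_add_distrib]
  congr 1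
  · simp only [trace, Matrix.diag_apply, Finset.sum_mul_sum]
    refine Finset.sum_congr rfl fun i _ => ?_
    rw [Finset.sum_eq_single i (by intro b _ hb; simp [Ne.symm hb]) (by simp)]
    refine Finset.sum_congr rfl fun k _ => ?_
    rw [Finset.sum_eq_single k (by intro b _ hb; simp [Ne.symm hb]) (by simp)]
    simp
  · simp only [trace, Matrix.diag_apply, Matrix.mul_apply]
    refine Finset.sum_congr rfl fun i _ => ?_
    refine Finset.sum_congr rfl fun j _ => ?_
    rw [Finset.sum_eq_single j (by intro b _ hb; simp [hb]) (by simp)]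
    rw [Finset.sum_eq_single i (by intro b _ hb; simp [Ne.symm hb]) (by simp)]
    simp

end Wick

/-! ### Measure preserving maps between Gaussian vectors -/

/-- A measure on the flat product is determined by boxes, so uncurrying is checked on boxes and
currying follows as its inverse. -/
lemma measurePreserving_curry_stdComplexGaussianPi (I J : Type*) [Fintype I] [Fintype J] :
    MeasurePreserving (fun (x : I × J → ℂ) i j => x (i, j)) (stdComplexGaussianPi (I × J))
      (Measure.pi fun _ : I => stdComplexGaussianPi J) := by
  have hm : Measurable (fun (x : I → J → ℂ) (q : I × J) => x q.1 q.2) := by fun_prop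
  have h : (Measure.pi fun _ : I => stdComplexGaussianPi J).map
      (fun (x : I → J → ℂ) (q : I × J) => x q.1 q.2) = stdComplexGaussianPi (I × J) := by
    refine (Measure.pi_eq fun s hs => ?_).symm
    rw [Measure.map_apply hm (MeasurableSet.univ_pi hs)]
    have : (fun (x : I → J → ℂ) (q : I × J) => x q.1 q.2) ⁻¹' Set.univ.pi s =
        Set.univ.pi fun i => Set.univ.pi fun j => s (i, j) := by
      ext x
      simp [Set.mem_pi]
    rw [this, Measure.pi_pi]
    simp_rw [Measure.pi_pi]
    rw [Fintype.prod_prod_type]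
  refine ⟨by fun_prop, ?_⟩
  rw [← h, Measure.map_map (by fun_prop) hm]
  exact Measure.map_id

lemma measurePreserving_sum_stdComplexGaussianPi (I J : Type*) [Fintype I] [Fintype J] :
    MeasurePreserving (fun x : I ⊕ J → ℂ => ((fun i => x (Sum.inl i)), fun j => x (Sum.inr j)))
      (stdComplexGaussianPi (I ⊕ J)) ((stdComplexGaussianPi I).prod (stdComplexGaussianPi J)) :=
  measurePreserving_sumPiEquivProdPi (X := fun _ : I ⊕ J => ℂ) fun _ => stdComplexGaussian

lemma measurePreserving_conj_stdComplexGaussianPi (J : Type*) [Fintype J] :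
    MeasurePreserving (fun (x : J → ℂ) j => conj (x j)) (stdComplexGaussianPi J)
      (stdComplexGaussianPi J) :=
  measurePreserving_pi _ _ fun _ =>
    ⟨Complex.continuous_conj.measurable, stdComplexGaussian_map_conj⟩

lemma measurePreserving_prod_leftComm {α β γ : Type*} [MeasurableSpace α] [MeasurableSpace β]
    [MeasurableSpace γ] (μ : Measure α) (ν : Measure β) (ξ : Measure γ) [SFinite μ] [SFinite ν]
    [SFinite ξ] :
    MeasurePreserving (fun q : α × β × γ => (q.2.1, q.1, q.2.2)) (μ.prod (ν.prod ξ))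
      (ν.prod (μ.prod ξ)) :=
  (measurePreserving_prodAssoc ν μ ξ).comp
    ((Measure.measurePreserving_swap.prod (MeasurePreserving.id ξ)).comp
      ((measurePreserving_prodAssoc μ ν ξ).symm))

lemma measurePreserving_complexGaussian (b : ℝ) :
    MeasurePreserving (fun x : ℂ => (Real.sqrt b : ℂ) * x) stdComplexGaussian
      (complexGaussian b) := ⟨by fun_prop, rfl⟩

lemma measurable_mulVec {m n : Type*} [Fintype m] [Fintype n] (A : Matrix m n ℂ) :
    Measurable (fun x : n → ℂ => A *ᵥ x) := by
  unfold Matrix.mulVec dotProduct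
  fun_prop

open scoped MatrixOrder in
lemma measurePreserving_complexGaussianVec {N : ℕ} (R : Matrix (Fin N) (Fin N) ℂ) :
    MeasurePreserving (fun x => CFC.sqrt R *ᵥ x) (stdComplexGaussianPi (Fin N))
      (complexGaussianVec R) := ⟨measurable_mulVec _, rfl⟩

instance (b : ℝ) : IsProbabilityMeasure (complexGaussian b) :=
  Measure.isProbabilityMeasure_map (by fun_prop)

instance {N : ℕ} (R : Matrix (Fin N) (Fin N) ℂ) : IsProbabilityMeasure (complexGaussianVec R) :=
  Measure.isProbabilityMeasure_map (measurable_mulVec _).aemeasurable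

/-! ### Channels and noise as images of independent standard sources -/

namespace RISSystem

variable {M K N τp n : ℕ} (S : RISSystem M K N τp)

instance : IsProbabilityMeasure (S.channelLaw n) := by
  unfold channelLaw
  infer_instance

/-- The indices of the independent sources of randomness other than the RIS-user channels: direct
channels, AP-RIS channels, pilot noise, data noise. -/
abbrev SourceIndex (M K N τp n : ℕ) : Type :=
  (Fin M × Fin K) ⊕ (Fin M × Fin N) ⊕ (Fin M × Fin τp) ⊕ (Fin M × Fin n)

open scoped MatrixOrder in
/-- The channels and the noise as a function of independent sources of randomness. The entries that
generate the AP-RIS channels are conjugated, so that `u` becomes linear in the second argument. -/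
noncomputable def ofSources (q : (Fin K × Fin N → ℂ) × (SourceIndex M K N τp n → ℂ)) :
    ChannelSample M K N τp n :=
  (fun m k => (Real.sqrt (S.β m k) : ℂ) * q.2 (Sum.inl (m, k)),
   fun m => CFC.sqrt (S.R m) *ᵥ fun i => conj (q.2 (Sum.inr (Sum.inl (m, i)))),
   fun k => CFC.sqrt (S.Rt k) *ᵥ fun i => q.1 (k, i),
   fun m i => q.2 (Sum.inr (Sum.inr (Sum.inl (m, i)))),
   fun m i => q.2 (Sum.inr (Sum.inr (Sum.inr (m, i)))))

/-- The law of the sources of randomness. -/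
noncomputable abbrev sourceLaw (M K N τp n : ℕ) :
    Measure ((Fin K × Fin N → ℂ) × (SourceIndex M K N τp n → ℂ)) :=
  (stdComplexGaussianPi (Fin K × Fin N)).prod (stdComplexGaussianPi (SourceIndex M K N τp n))

/-- Each block of sources is mapped separately onto its channel or noise law. The block behind `z`
is kept apart from the others because the moments are computed conditionally on it. -/
lemma measurePreserving_ofSources :
    MeasurePreserving (S.ofSources (n := n)) (sourceLaw M K N τp n) (S.channelLaw n) := by
  have hg : MeasurePreserving
      (fun (x : Fin M × Fin K → ℂ) m k => (Real.sqrt (S.β m k) : ℂ) * x (m, k))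
      (stdComplexGaussianPi (Fin M × Fin K))
      (Measure.pi fun m => Measure.pi fun k => complexGaussian (S.β m k)) :=
    (measurePreserving_pi _ _ fun m => measurePreserving_pi _ _ fun k =>
      measurePreserving_complexGaussian (S.β m k)).comp
      (measurePreserving_curry_stdComplexGaussianPi (Fin M) (Fin K))
  have hh := (measurePreserving_pi _ _ fun m => (measurePreserving_complexGaussianVec (S.R m)).comp
      (measurePreserving_conj_stdComplexGaussianPi (Fin N))).comp
      (measurePreserving_curry_stdComplexGaussianPi (Fin M) (Fin N))
  have hz := (measurePreserving_pi _ _ fun k => measurePreserving_complexGaussianVec (S.Rt k)).comp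
      (measurePreserving_curry_stdComplexGaussianPi (Fin K) (Fin N))
  have hp := measurePreserving_curry_stdComplexGaussianPi (Fin M) (Fin τp)
  have hd := measurePreserving_curry_stdComplexGaussianPi (Fin M) (Fin n)
  have hsplit := (MeasurePreserving.id (stdComplexGaussianPi (Fin M × Fin K))).prod
    (((MeasurePreserving.id (stdComplexGaussianPi (Fin M × Fin N))).prod
      (measurePreserving_sum_stdComplexGaussianPi (Fin M × Fin τp) (Fin M × Fin n))).comp
      (measurePreserving_sum_stdComplexGaussianPi (Fin M × Fin N) _)) |>.comp
      (measurePreserving_sum_stdComplexGaussianPi (Fin M × Fin K) _)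
  -- Splits the sources into blocks and moves the one behind `z` from first to third place, as in
  -- `ChannelSample`.
  have hcomm := (((MeasurePreserving.id (stdComplexGaussianPi (Fin M × Fin K))).prod
      (measurePreserving_prod_leftComm (stdComplexGaussianPi (Fin K × Fin N))
      (stdComplexGaussianPi (Fin M × Fin N)) ((stdComplexGaussianPi (Fin M × Fin τp)).prod
        (stdComplexGaussianPi (Fin M × Fin n))))).comp
      (measurePreserving_prod_leftComm (stdComplexGaussianPi (Fin K × Fin N)) _ _)).comp
      ((MeasurePreserving.id (stdComplexGaussianPi (Fin K × Fin N))).prod hsplit)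
  exact (hg.prod (hh.prod (hz.prod (hp.prod hd)))).comp hcomm

/-! ### The signals as linear forms in the sources -/

open scoped MatrixOrder in
/-- The vector `z_k` as a function of the sources. -/
noncomputable def zOf (k : Fin K) (z : Fin K × Fin N → ℂ) : Fin N → ℂ :=
  CFC.sqrt (S.Rt k) *ᵥ fun i => z (k, i)

open scoped MatrixOrder in
/-- Coefficients of `u_{mk}` as a linear form. -/
noncomputable def uCoeff (n : ℕ) (m : Fin M) (k : Fin K) (z : Fin K × Fin N → ℂ) :
    SourceIndex M K N τp n → ℂ :=
  Sum.elim (fun a => if a = (m, k) then (Real.sqrt (S.β m k) : ℂ) else 0)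
    (Sum.elim (fun a => if a.1 = m then ((CFC.sqrt (S.R m))ᴴ *ᵥ (S.Φ *ᵥ S.zOf k z)) a.2 else 0) 0)

/-- Coefficients of the projected pilot noise as a linear form. -/
def noiseCoeff (n : ℕ) (m : Fin M) (k : Fin K) : SourceIndex M K N τp n → ℂ :=
  Sum.elim 0 (Sum.elim 0 (Sum.elim (fun a => if a.1 = m then conj (S.φ k a.2) else 0) 0))

/-- Coefficients of `y_{mk}` as a linear form. -/
noncomputable def yCoeff (n : ℕ) (m : Fin M) (k : Fin K) (z : Fin K × Fin N → ℂ) :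
    SourceIndex M K N τp n → ℂ :=
  (Real.sqrt (S.p * τp) : ℂ) • ∑ a ∈ S.pilotSet k, S.uCoeff n m a z + S.noiseCoeff n m k

/-- Coefficients of the data noise as a linear form. -/
def dataNoiseCoeff (M K N τp : ℕ) {n : ℕ} (m : Fin M) (i : Fin n) : SourceIndex M K N τp n → ℂ :=
  Sum.elim 0 (Sum.elim 0 (Sum.elim 0 fun a => if a = (m, i) then 1 else 0))

lemma mem_pilotSet {k k' : Fin K} : k' ∈ S.pilotSet k ↔ S.φ k' = S.φ k := by
  classical
  simp [pilotSet]

lemma star_φ_dotProduct (k k' : Fin K) :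
    star (S.φ k) ⬝ᵥ S.φ k' = if S.φ k' = S.φ k then 1 else 0 := by
  split_ifs with h
  · rw [h, S.φ_unit]
  · exact S.φ_orth _ _ (Ne.symm h)

/-- Projection on a unit-norm pilot removes the users with orthogonal pilots and keeps the others
with weight one; this is pilot contamination. -/
lemma y_eq (m : Fin M) (k : Fin K) (ω : ChannelSample M K N τp n) :
    S.y m k ω = (Real.sqrt (S.p * τp) : ℂ) * (∑ a ∈ S.pilotSet k, S.u m a ω) +
      star (S.φ k) ⬝ᵥ ω.2.2.2.1 m := by
  classical
  rw [y, pilotSignal, dotProduct_add, dotProduct_sum]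
  congr 1
  simp_rw [dotProduct_smul, star_φ_dotProduct, Finset.mul_sum, pilotSet, Finset.sum_filter]
  exact Finset.sum_congr rfl fun a _ => by split_ifs <;> simp

lemma u_ofSources (m : Fin M) (k : Fin K)
    (q : (Fin K × Fin N → ℂ) × (SourceIndex M K N τp n → ℂ)) :
    S.u m k (S.ofSources q) = S.uCoeff n m k q.1 ⬝ᵥ q.2 := by
  simp only [u, ofSources, uCoeff, dotProduct, Fintype.sum_sum_type, Sum.elim_inl, Sum.elim_inr]
  congr 1
  · simp
  · rw [Fintype.sum_prod_type]
    simp only [ite_mul, zero_mul, Pi.zero_apply,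
      Finset.sum_const_zero, add_zero]
    rw [Finset.sum_comm]
    simp only [Finset.sum_ite_eq', Finset.mem_univ, if_true]
    change star _ ⬝ᵥ _ = (_ *ᵥ _) ⬝ᵥ fun i => q.2 (Sum.inr (Sum.inl (m, i)))
    rw [star_mulVec, ← dotProduct_mulVec, dotProduct_comm]
    congr 1
    ext i
    simp

lemma y_ofSources (m : Fin M) (k : Fin K)
    (q : (Fin K × Fin N → ℂ) × (SourceIndex M K N τp n → ℂ)) :
    S.y m k (S.ofSources q) = S.yCoeff n m k q.1 ⬝ᵥ q.2 := by
  rw [y_eq, yCoeff, add_dotProduct, smul_dotProduct, sum_dotProduct]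
  congr 1
  · simp_rw [u_ofSources, smul_eq_mul]
  · simp only [ofSources, noiseCoeff, dotProduct, Fintype.sum_sum_type, Sum.elim_inl, Sum.elim_inr,
      Fintype.sum_prod_type, ite_mul, zero_mul, Pi.zero_apply, Finset.sum_const_zero, add_zero,
      zero_add]
    rw [Finset.sum_comm]
    simp

lemma dataNoise_ofSources (m : Fin M) (i : Fin n)
    (q : (Fin K × Fin N → ℂ) × (SourceIndex M K N τp n → ℂ)) :
    (S.ofSources q).2.2.2.2 m i = dataNoiseCoeff M K N τp m i ⬝ᵥ q.2 := by
  simp [ofSources, dataNoiseCoeff, dotProduct, Fintype.sum_sum_type]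

/-! ### Covariances of the signals given the RIS-user channels -/

open scoped MatrixOrder in
/-- The matrix of the sesquilinear form `z_a^H Φ^H R_m Φ z_b` of the standard vectors that generate
`z_a` and `z_b`. -/
noncomputable def kernel (m : Fin M) (a b : Fin K) : Matrix (Fin N) (Fin N) ℂ :=
  CFC.sqrt (S.Rt a) * (S.Φᴴ * S.R m * S.Φ) * CFC.sqrt (S.Rt b)

/-- The covariance of `u_{ma}` and `u_{mb}` given the RIS-user channels. -/
noncomputable def condCov (m : Fin M) (a b : Fin K) (z : Fin K × Fin N → ℂ) : ℂ :=
  (if a = b then (S.β m a : ℂ) else 0) +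
    star z ⬝ᵥ (kroneckerMap (· * ·) (Matrix.single a b (1 : ℂ)) (S.kernel m a b)) *ᵥ z

open scoped MatrixOrder in
lemma isHermitian_sqrt (A : Matrix (Fin N) (Fin N) ℂ) : (CFC.sqrt A)ᴴ = CFC.sqrt A :=
  (Matrix.nonneg_iff_posSemidef.1 (CFC.sqrt_nonneg A)).isHermitian

open scoped MatrixOrder in
lemma sqrt_mul_sqrt {A : Matrix (Fin N) (Fin N) ℂ} (hA : A.PosSemidef) :
    CFC.sqrt A * CFC.sqrt A = A :=
  CFC.sqrt_mul_sqrt_self A (Matrix.nonneg_iff_posSemidef.2 hA)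

/-- The Kronecker factor `single a b 1` places `X` in block `(a, b)`. Forms that couple different
users thereby become quadratic forms in one Gaussian vector, to which the trace formulas apply. -/
lemma star_dotProduct_kronecker_single_mulVec (a b : Fin K) (X : Matrix (Fin N) (Fin N) ℂ)
    (z : Fin K × Fin N → ℂ) :
    star z ⬝ᵥ (kroneckerMap (· * ·) (Matrix.single a b (1 : ℂ)) X) *ᵥ z =
      star (fun i => z (a, i)) ⬝ᵥ X *ᵥ fun i => z (b, i) := by
  rw [quadraticForm_eq_sum, Fintype.sum_prod_type, Finset.sum_eq_single a]
  · simp only [dotProduct, mulVec, Finset.mul_sum]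
    refine Finset.sum_congr rfl fun i _ => ?_
    rw [Fintype.sum_prod_type, Finset.sum_eq_single b]
    · refine Finset.sum_congr rfl fun j _ => ?_
      simp
      ring
    · intro c _ hc
      simp [Ne.symm hc]
    · simp
  · intro c _ hc
    simp [Ne.symm hc]
  · simp

/-- Different access points draw on disjoint sources. At the same one, the direct links of distinct
users are orthogonal, and the RIS parts combine through `R^{1/2} R^{1/2} = R`. -/
lemma star_uCoeff_dotProduct (m m' : Fin M) (a b : Fin K) (z : Fin K × Fin N → ℂ) :
    star (S.uCoeff n m a z) ⬝ᵥ S.uCoeff n m' b z = if m = m' then S.condCov m a b z else 0 := by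
  split_ifs with h
  · subst h
    simp only [uCoeff, dotProduct, Fintype.sum_sum_type, Pi.star_apply, Sum.elim_inl,
      Sum.elim_inr, condCov]
    congr 1
    · rw [Finset.sum_eq_single (m, a)]
      · by_cases hab : a = b
        · subst hab
          simp [← Complex.ofReal_mul, Real.mul_self_sqrt (S.β_nonneg m a)]
        · simp [hab]
      · intro c _ hc
        simp [hc]
      · simp
    · rw [Fintype.sum_prod_type, Finset.sum_eq_single m]
      · simp only [if_true, Pi.zero_apply, star_zero, zero_mul, Finset.sum_const_zero, add_zero]
        change star (_ *ᵥ _) ⬝ᵥ (_ *ᵥ _) = star z ⬝ᵥ _ *ᵥ z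
        rw [star_dotProduct_kronecker_single_mulVec, star_mulVec, conjTranspose_conjTranspose,
          ← dotProduct_mulVec, mulVec_mulVec, isHermitian_sqrt, sqrt_mul_sqrt (S.R_psd m),
          star_mulVec, ← dotProduct_mulVec, zOf, star_mulVec, ← dotProduct_mulVec,
          isHermitian_sqrt]
        simp only [zOf, mulVec_mulVec, kernel, Matrix.mul_assoc]
      · intro c _ hc
        simp [hc]
      · simp
  · simp only [uCoeff, dotProduct, Fintype.sum_sum_type, Pi.star_apply, Sum.elim_inl,
      Sum.elim_inr, Fintype.sum_prod_type, Prod.mk.injEq]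
    have h1 : ∀ c : Fin M, c = m → ¬ c = m' := fun c h1 h2 => h (h1.symm.trans h2)
    rw [Finset.sum_eq_zero, Finset.sum_eq_zero]
    · simp
    · intro c _
      by_cases hc : c = m
      · simp [hc, h]
      · simp [hc]
    · intro c _
      by_cases hc : c = m
      · simp [hc, h]
      · simp [hc]

lemma star_noiseCoeff_dotProduct (m m' : Fin M) (k : Fin K) :
    star (S.noiseCoeff n m k) ⬝ᵥ S.noiseCoeff n m' k = if m = m' then 1 else 0 := by
  have h0 : ∑ i, S.φ k i * conj (S.φ k i) = 1 := by
    rw [← S.φ_unit k]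
    exact Finset.sum_congr rfl fun i _ => mul_comm _ _
  simp only [noiseCoeff, dotProduct, Fintype.sum_sum_type, Pi.star_apply, Sum.elim_inl,
      Sum.elim_inr, Pi.zero_apply, mul_zero, Finset.sum_const_zero, zero_add, add_zero]
  rw [Fintype.sum_prod_type, Finset.sum_eq_single m (by intro c _ hc; simp [hc]) (by simp)]
  split_ifs <;> simp [h0]

lemma star_noiseCoeff_dotProduct_uCoeff (m m' : Fin M) (k a : Fin K) (z : Fin K × Fin N → ℂ) :
    star (S.noiseCoeff n m k) ⬝ᵥ S.uCoeff n m' a z = 0 := by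
  simp [noiseCoeff, uCoeff, dotProduct, Fintype.sum_sum_type]

lemma star_uCoeff_dotProduct_noiseCoeff (m m' : Fin M) (k a : Fin K) (z : Fin K × Fin N → ℂ) :
    star (S.uCoeff n m' a z) ⬝ᵥ S.noiseCoeff n m k = 0 := by
  simp [noiseCoeff, uCoeff, dotProduct, Fintype.sum_sum_type]

lemma star_yCoeff_dotProduct_uCoeff (m m' : Fin M) (k a : Fin K) (z : Fin K × Fin N → ℂ) :
    star (S.yCoeff n m k z) ⬝ᵥ S.uCoeff n m' a z =
      if m = m' then (Real.sqrt (S.p * τp) : ℂ) * ∑ b ∈ S.pilotSet k, S.condCov m b a z else 0 := by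
  rw [yCoeff, star_add, add_dotProduct, star_noiseCoeff_dotProduct_uCoeff, star_smul,
    smul_dotProduct, star_sum, sum_dotProduct]
  simp_rw [star_uCoeff_dotProduct]
  split_ifs <;> simp

lemma star_uCoeff_dotProduct_yCoeff (m m' : Fin M) (k a : Fin K) (z : Fin K × Fin N → ℂ) :
    star (S.uCoeff n m a z) ⬝ᵥ S.yCoeff n m' k z =
      if m = m' then (Real.sqrt (S.p * τp) : ℂ) * ∑ b ∈ S.pilotSet k, S.condCov m a b z else 0 := by
  rw [yCoeff, dotProduct_add, star_uCoeff_dotProduct_noiseCoeff, dotProduct_smul, dotProduct_sum]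
  simp_rw [star_uCoeff_dotProduct]
  split_ifs <;> simp

lemma star_noiseCoeff_dotProduct_yCoeff (m m' : Fin M) (k : Fin K) (z : Fin K × Fin N → ℂ) :
    star (S.noiseCoeff n m k) ⬝ᵥ S.yCoeff n m' k z = if m = m' then 1 else 0 := by
  rw [yCoeff, dotProduct_add, star_noiseCoeff_dotProduct, dotProduct_smul, dotProduct_sum]
  simp [star_noiseCoeff_dotProduct_uCoeff]

/-- The double sum collects the covariances of all pairs of users sharing the pilot. Off-diagonal
pairs are correlated for fixed `z` and disappear only after averaging over `z`. -/
lemma star_yCoeff_dotProduct_yCoeff (m m' : Fin M) (k : Fin K) (z : Fin K × Fin N → ℂ) :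
    star (S.yCoeff n m k z) ⬝ᵥ S.yCoeff n m' k z =
      if m = m' then ((S.p * τp : ℝ) : ℂ) *
        (∑ a ∈ S.pilotSet k, ∑ b ∈ S.pilotSet k, S.condCov m a b z) + 1 else 0 := by
  have h : ((S.p * τp : ℝ) : ℂ) = (Real.sqrt (S.p * τp) : ℂ) * (Real.sqrt (S.p * τp) : ℂ) := by
    rw [← Complex.ofReal_mul, Real.mul_self_sqrt (mul_nonneg S.p_nonneg (Nat.cast_nonneg _))]
  nth_rewrite 1 [yCoeff]
  rw [star_add, add_dotProduct, star_noiseCoeff_dotProduct_yCoeff, star_smul,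
    smul_dotProduct, star_sum, sum_dotProduct]
  simp_rw [star_uCoeff_dotProduct_yCoeff]
  split_ifs
  · rw [h, ← Finset.mul_sum]
    simp
    ring
  · simp

lemma star_dataNoiseCoeff_dotProduct (m m' : Fin M) (i : Fin n) :
    star (dataNoiseCoeff M K N τp m i) ⬝ᵥ dataNoiseCoeff M K N τp m' i =
      if m = m' then 1 else 0 := by
  simp only [dataNoiseCoeff, dotProduct, Fintype.sum_sum_type, Pi.star_apply, Sum.elim_inl,
      Sum.elim_inr, Pi.zero_apply, mul_zero, Finset.sum_const_zero, zero_add]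
  rw [Finset.sum_eq_single (m, i) (by intro c _ hc; simp [hc]) (by simp)]
  simp

lemma star_yCoeff_dotProduct_dataNoiseCoeff (m m' : Fin M) (k : Fin K) (i : Fin n)
    (z : Fin K × Fin N → ℂ) :
    star (S.yCoeff n m k z) ⬝ᵥ dataNoiseCoeff M K N τp m' i = 0 := by
  rw [yCoeff, star_add, add_dotProduct, star_smul, smul_dotProduct, star_sum, sum_dotProduct]
  simp [uCoeff, noiseCoeff, dataNoiseCoeff, dotProduct, Fintype.sum_sum_type]

end RISSystem

lemma FiniteMoments.of_comp {Ω Ω' : Type*} [MeasurableSpace Ω] [MeasurableSpace Ω']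
    {μ : Measure Ω} {ν : Measure Ω'} {f : Ω' → ℂ} {T : Ω → Ω'} (hT : MeasurePreserving T μ ν)
    (hf : Measurable f) (h : FiniteMoments (fun x => f (T x)) μ) : FiniteMoments f ν := by
  intro p hp
  rw [← hT.map_eq]
  exact (memLp_map_measure_iff hf.aestronglyMeasurable hT.measurable.aemeasurable).2 (h p hp)

namespace RISSystem

variable {M K N τp n : ℕ} (S : RISSystem M K N τp)

/-! ### Moments of the conditional covariances -/

open scoped MatrixOrder in
-- Cyclicity of the trace brings the two square roots of `R̃_a` together.
lemma trace_kernel (m : Fin M) (a : Fin K) : (S.kernel m a a).trace = (S.Θ m a).trace := by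
  rw [kernel, Matrix.trace_mul_comm, ← Matrix.mul_assoc, sqrt_mul_sqrt (S.Rt_psd a),
    Matrix.trace_mul_comm, Θ]

open scoped MatrixOrder in
lemma posSemidef_kernel (m : Fin M) (a : Fin K) : (S.kernel m a a).PosSemidef := by
  have h1 : (S.Φᴴ * S.R m * S.Φ).PosSemidef := (S.R_psd m).conjTranspose_mul_mul_same S.Φ
  have h2 := h1.conjTranspose_mul_mul_same (CFC.sqrt (S.Rt a))
  rwa [isHermitian_sqrt] at h2

/-- `Θ` itself need not be Hermitian, but its trace is that of the positive semidefinite `kernel`.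
Nonnegativity in the order of `ℂ` includes being real, which justifies taking the real part in `δ`.
-/
lemma trace_Θ_nonneg (m : Fin M) (a : Fin K) : 0 ≤ (S.Θ m a).trace := by
  rw [← trace_kernel]
  exact (S.posSemidef_kernel m a).trace_nonneg

lemma δ_nonneg (m : Fin M) (a : Fin K) : 0 ≤ S.δ m a :=
  add_nonneg (S.β_nonneg m a) (Complex.le_def.1 (S.trace_Θ_nonneg m a)).1

lemma ofReal_δ (m : Fin M) (a : Fin K) : (S.δ m a : ℂ) = S.β m a + (S.Θ m a).trace := by
  rw [δ, Complex.ofReal_add]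
  congr 1
  exact Complex.ext (by simp) (by simpa using (Complex.le_def.1 (S.trace_Θ_nonneg m a)).2)

open scoped MatrixOrder in
lemma trace_kernel_mul_kernel (m m' : Fin M) (a b : Fin K) :
    (S.kernel m a b * S.kernel m' b a).trace = (S.Θ m b * S.Θ m' a).trace := by
  have : S.kernel m a b * S.kernel m' b a = CFC.sqrt (S.Rt a) *
      (S.Φᴴ * S.R m * S.Φ * (CFC.sqrt (S.Rt b) * CFC.sqrt (S.Rt b)) *
        (S.Φᴴ * S.R m' * S.Φ) * CFC.sqrt (S.Rt a)) := by
    simp only [kernel, Matrix.mul_assoc]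
  rw [this, Matrix.trace_mul_comm, Matrix.mul_assoc, sqrt_mul_sqrt (S.Rt_psd a),
    sqrt_mul_sqrt (S.Rt_psd b)]
  simp only [Θ, Matrix.mul_assoc]

lemma trace_kronecker_kernel (m : Fin M) (a b : Fin K) :
    (if a = b then (S.β m a : ℂ) else 0) +
      (kroneckerMap (· * ·) (Matrix.single a b (1 : ℂ)) (S.kernel m a b)).trace =
      if a = b then (S.δ m a : ℂ) else 0 := by
  rw [trace_kronecker]
  split_ifs with h
  · subst h
    rw [trace_kernel, ofReal_δ]
    simp
  · rw [Matrix.trace_single_eq_of_ne _ _ _ h]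
    simp

lemma finiteMoments_condCov (m : Fin M) (a b : Fin K) :
    FiniteMoments (S.condCov m a b) (stdComplexGaussianPi (Fin K × Fin N)) :=
  (FiniteMoments.const _).add (finiteMoments_quadraticForm _)

lemma integral_condCov (m : Fin M) (a b : Fin K) :
    ∫ z, S.condCov m a b z ∂(stdComplexGaussianPi (Fin K × Fin N)) =
      if a = b then (S.δ m a : ℂ) else 0 := by
  rw [← trace_kronecker_kernel]
  simp only [condCov]
  rw [integral_add (integrable_const _) (finiteMoments_quadraticForm _).integrable,
    integral_quadraticForm]
  simp

/-- With constants `s`, `t` and quadratic forms of matrices `P`, `Q`, the mean is `(s + tr P)(t + tr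
Q) + tr(PQ)`. The block product `(a,b)(c,d)` vanishes unless `b = c`, and its trace vanishes unless
also `a = d`. -/
lemma integral_condCov_mul_condCov (m m' : Fin M) (a b c d : Fin K) :
    ∫ z, S.condCov m a b z * S.condCov m' c d z ∂(stdComplexGaussianPi (Fin K × Fin N)) =
      (if a = b then (S.δ m a : ℂ) else 0) * (if c = d then (S.δ m' c : ℂ) else 0) +
      if b = c ∧ a = d then (S.Θ m b * S.Θ m' a).trace else 0 := by
  set P := kroneckerMap (· * ·) (Matrix.single a b (1 : ℂ)) (S.kernel m a b) with hP
  set Q := kroneckerMap (· * ·) (Matrix.single c d (1 : ℂ)) (S.kernel m' c d) with hQ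
  have hPQ : (P * Q).trace = if b = c ∧ a = d then (S.Θ m b * S.Θ m' a).trace else 0 := by
    rw [hP, hQ, ← Matrix.mul_kronecker_mul, trace_kronecker]
    by_cases h1 : b = c
    · subst h1
      by_cases h2 : a = d
      · subst h2
        rw [trace_kernel_mul_kernel]
        simp
      · simp [h2, Matrix.trace_single_eq_of_ne]
    · simp [h1]
  rw [← trace_kronecker_kernel, ← trace_kronecker_kernel, ← hPQ]
  set s : ℂ := if a = b then (S.β m a : ℂ) else 0 with hs
  set t : ℂ := if c = d then (S.β m' c : ℂ) else 0 with ht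
  have e : ∀ z, S.condCov m a b z * S.condCov m' c d z =
      s * t + s * (star z ⬝ᵥ Q *ᵥ z) + t * (star z ⬝ᵥ P *ᵥ z) +
        (star z ⬝ᵥ P *ᵥ z) * (star z ⬝ᵥ Q *ᵥ z) := by
    intro z
    simp only [condCov]
    ring
  have iP := finiteMoments_quadraticForm P
  have iQ := finiteMoments_quadraticForm Q
  have i1 : FiniteMoments (fun _ => s * t) (stdComplexGaussianPi (Fin K × Fin N)) :=
    FiniteMoments.const _
  simp_rw [e]
  rw [integral_add ((i1.add (iQ.const_mul s)).add (iP.const_mul t)).integrable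
      (iP.mul iQ).integrable,
    integral_add (i1.add (iQ.const_mul s)).integrable (iP.const_mul t).integrable,
    integral_add i1.integrable (iQ.const_mul s).integrable, integral_const, integral_const_mul,
    integral_const_mul, integral_quadraticForm, integral_quadraticForm,
    integral_quadraticForm_mul]
  simp
  ring

/-! ### Moments of the signals -/

lemma measurable_u (m : Fin M) (k : Fin K) : Measurable (S.u (n := n) m k) := by
  unfold u Matrix.mulVec dotProduct
  simp only [Pi.star_apply, RCLike.star_def]
  fun_prop

lemma measurable_y (m : Fin M) (k : Fin K) : Measurable (S.y (n := n) m k) := by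
  have hu := fun a => S.measurable_u (n := n) m a
  have : S.y (n := n) m k = fun ω => (Real.sqrt (S.p * τp) : ℂ) *
      (∑ a ∈ S.pilotSet k, S.u m a ω) + star (S.φ k) ⬝ᵥ ω.2.2.2.1 m :=
    funext fun ω => S.y_eq m k ω
  rw [this]
  unfold dotProduct
  fun_prop

lemma finiteMoments_source (j : SourceIndex M K N τp n) :
    FiniteMoments (fun q : (Fin K × Fin N → ℂ) × (SourceIndex M K N τp n → ℂ) => q.2 j)
      (sourceLaw M K N τp n) :=
  (finiteMoments_eval_stdComplexGaussianPi j).comp measurePreserving_snd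

lemma finiteMoments_directChannel (m : Fin M) (k : Fin K) :
    FiniteMoments (fun ω : ChannelSample M K N τp n => ω.1 m k) (S.channelLaw n) :=
  FiniteMoments.of_comp S.measurePreserving_ofSources (by fun_prop)
    ((finiteMoments_source _).const_mul _)

open scoped MatrixOrder in
lemma finiteMoments_risChannel (m : Fin M) (i : Fin N) :
    FiniteMoments (fun ω : ChannelSample M K N τp n => ω.2.1 m i) (S.channelLaw n) := by
  refine FiniteMoments.of_comp S.measurePreserving_ofSources (by fun_prop) ?_
  change FiniteMoments (fun q : (Fin K × Fin N → ℂ) × (SourceIndex M K N τp n → ℂ) =>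
    (fun j => CFC.sqrt (S.R m) i j) ⬝ᵥ fun j => conj (q.2 (Sum.inr (Sum.inl (m, j))))) _
  exact FiniteMoments.dotProduct (fun _ => FiniteMoments.const _)
      fun j => (finiteMoments_source _).conjugate

open scoped MatrixOrder in
lemma finiteMoments_userChannel (k : Fin K) (i : Fin N) :
    FiniteMoments (fun ω : ChannelSample M K N τp n => ω.2.2.1 k i) (S.channelLaw n) := by
  refine FiniteMoments.of_comp S.measurePreserving_ofSources (by fun_prop) ?_
  change FiniteMoments (fun q : (Fin K × Fin N → ℂ) × (SourceIndex M K N τp n → ℂ) =>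
    (fun j => CFC.sqrt (S.Rt k) i j) ⬝ᵥ fun j => q.1 (k, j)) _
  exact FiniteMoments.dotProduct (fun _ => FiniteMoments.const _)
      fun j => (finiteMoments_eval_stdComplexGaussianPi _).comp measurePreserving_fst

lemma finiteMoments_u (m : Fin M) (k : Fin K) :
    FiniteMoments (S.u (n := n) m k) (S.channelLaw n) := by
  refine (S.finiteMoments_directChannel m k).add (FiniteMoments.dotProduct
    (fun i => (S.finiteMoments_risChannel m i).conjugate) fun i => ?_)
  exact FiniteMoments.dotProduct (fun _ => FiniteMoments.const _)
    fun j => S.finiteMoments_userChannel k j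

lemma finiteMoments_pilotNoise (m : Fin M) (i : Fin τp) :
    FiniteMoments (fun ω : ChannelSample M K N τp n => ω.2.2.2.1 m i) (S.channelLaw n) :=
  FiniteMoments.of_comp S.measurePreserving_ofSources (by fun_prop) (finiteMoments_source _)

lemma finiteMoments_dataNoise (m : Fin M) (i : Fin n) :
    FiniteMoments (fun ω : ChannelSample M K N τp n => ω.2.2.2.2 m i) (S.channelLaw n) :=
  FiniteMoments.of_comp S.measurePreserving_ofSources (by fun_prop) (finiteMoments_source _)

lemma finiteMoments_y (m : Fin M) (k : Fin K) :
    FiniteMoments (S.y (n := n) m k) (S.channelLaw n) := by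
  have : S.y (n := n) m k = fun ω => (Real.sqrt (S.p * τp) : ℂ) *
      (∑ a ∈ S.pilotSet k, S.u m a ω) + star (S.φ k) ⬝ᵥ ω.2.2.2.1 m :=
    funext fun ω => S.y_eq m k ω
  rw [this]
  exact ((FiniteMoments.sum _ fun a _ => S.finiteMoments_u m a).const_mul _).add
    (FiniteMoments.dotProduct (fun _ => FiniteMoments.const _)
      fun i => S.finiteMoments_pilotNoise m i)

/-- Conditioning on the RIS-user channels, by Fubini: the inner integral sees Gaussian linear forms
with frozen coefficients, the outer one averages their covariances. -/
lemma integral_channelLaw_eq {f : ChannelSample M K N τp n → ℂ}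
    (hf : FiniteMoments f (S.channelLaw n)) :
    ∫ ω, f ω ∂(S.channelLaw n) = ∫ z, ∫ x, f (S.ofSources (z, x))
      ∂(stdComplexGaussianPi (SourceIndex M K N τp n))
      ∂(stdComplexGaussianPi (Fin K × Fin N)) := by
  have h := hf.comp S.measurePreserving_ofSources
  rw [← integral_prod _ h.integrable, ← S.measurePreserving_ofSources.map_eq, integral_map
    S.measurePreserving_ofSources.measurable.aemeasurable]
  rw [S.measurePreserving_ofSources.map_eq]
  exact hf.integrable.aestronglyMeasurable

/-- Covariances between distinct users have mean zero over `z`, so only user `a` itself contributes,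
and only if it uses pilot `k`. -/
lemma integral_conj_y_mul_u (m : Fin M) (k a : Fin K) :
    ∫ ω, conj (S.y m k ω) * S.u m a ω ∂(S.channelLaw n) =
      if a ∈ S.pilotSet k then (Real.sqrt (S.p * τp) : ℂ) * S.δ m a else 0 := by
  rw [S.integral_channelLaw_eq ((S.finiteMoments_y m k).conjugate.mul (S.finiteMoments_u m a))]
  simp_rw [y_ofSources, u_ofSources, integral_conj_dotProduct_mul, star_yCoeff_dotProduct_uCoeff,
    if_true]
  rw [integral_const_mul, integral_finsetSum _ fun b _ => (S.finiteMoments_condCov m b a).integrable]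
  simp_rw [integral_condCov]
  rw [Finset.sum_ite_eq']
  simp

/-! ### Pilot power and the LMMSE coefficient -/

/-- The power of `y_{mk}`. -/
noncomputable def pilotPower (m : Fin M) (k : Fin K) : ℝ :=
  S.p * τp * (∑ k' ∈ S.pilotSet k, S.δ m k') + 1

lemma pilotPower_pos (m : Fin M) (k : Fin K) : 0 < S.pilotPower m k :=
  add_pos_of_nonneg_of_pos (mul_nonneg (mul_nonneg S.p_nonneg (Nat.cast_nonneg _))
    (Finset.sum_nonneg fun a _ => S.δ_nonneg m a)) one_pos

lemma integral_condPower (m : Fin M) (k : Fin K) :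
    ∫ z, (((S.p * τp : ℝ) : ℂ) * (∑ a ∈ S.pilotSet k, ∑ b ∈ S.pilotSet k, S.condCov m a b z) + 1)
      ∂(stdComplexGaussianPi (Fin K × Fin N)) = S.pilotPower m k := by
  have hi : ∀ a, FiniteMoments (fun z => ∑ b ∈ S.pilotSet k, S.condCov m a b z)
      (stdComplexGaussianPi (Fin K × Fin N)) :=
    fun a => FiniteMoments.sum _ fun b _ => S.finiteMoments_condCov m a b
  rw [integral_add ((FiniteMoments.sum _ fun a _ => hi a).const_mul _).integrable
    (integrable_const _), integral_const_mul, integral_finsetSum _ fun a _ => (hi a).integrable]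
  simp_rw [integral_finsetSum _ fun b _ => (S.finiteMoments_condCov m _ b).integrable,
    integral_condCov, Finset.sum_ite_eq]
  rw [Finset.sum_congr rfl fun a ha => if_pos ha, pilotPower]
  simp

lemma integral_conj_y_mul_y (m : Fin M) (k : Fin K) :
    ∫ ω, conj (S.y m k ω) * S.y m k ω ∂(S.channelLaw n) = S.pilotPower m k := by
  rw [S.integral_channelLaw_eq ((S.finiteMoments_y m k).conjugate.mul (S.finiteMoments_y m k)),
    ← integral_condPower]
  simp_rw [y_ofSources, integral_conj_dotProduct_mul, star_yCoeff_dotProduct_yCoeff, if_true]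

lemma c_eq (m : Fin M) (k : Fin K) :
    S.c m k = Real.sqrt (S.p * τp) * S.δ m k / S.pilotPower m k := rfl

/-- The normal equation of the LMMSE estimate. It reduces every `c² · pilotPower` to `γ`. -/
lemma c_mul_pilotPower (m : Fin M) (k : Fin K) :
    S.c m k * S.pilotPower m k = Real.sqrt (S.p * τp) * S.δ m k := by
  rw [c_eq, div_mul_cancel₀ _ (S.pilotPower_pos m k).ne']

lemma self_mem_pilotSet (k : Fin K) : k ∈ S.pilotSet k := S.mem_pilotSet.2 rfl

lemma integral_ofReal_norm_sq {Ω : Type*} [MeasurableSpace Ω] (μ : Measure Ω) (f : Ω → ℂ) :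
    ((∫ ω, ‖f ω‖ ^ 2 ∂μ : ℝ) : ℂ) = ∫ ω, conj (f ω) * f ω ∂μ := by
  rw [← integral_complex_ofReal]
  congr 1 with ω
  rw [Complex.conj_mul']
  simp

/-- The LMMSE estimate is a deterministic multiple of the projected training signal. -/
lemma uHat_eq (m : Fin M) (k : Fin K) (ω : ChannelSample M K N τp n) :
    S.uHat m k ω = S.c m k * S.y m k ω := by
  rw [uHat, integral_conj_y_mul_u, if_pos (S.self_mem_pilotSet k), integral_ofReal_norm_sq,
    integral_conj_y_mul_y, c_eq]
  push_cast
  rfl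

lemma gain_eq (k a : Fin K) (ω : ChannelSample M K N τp n) :
    S.gain k a ω = ∑ m, (S.c m k : ℂ) * (conj (S.y m k ω) * S.u m a ω) := by
  simp only [gain, uHat_eq, map_mul, Complex.conj_ofReal, mul_assoc]

lemma combinedNoise_eq (k : Fin K) (i : Fin n) (ω : ChannelSample M K N τp n) :
    S.combinedNoise k i ω = ∑ m, (S.c m k : ℂ) * (conj (S.y m k ω) * ω.2.2.2.2 m i) := by
  simp only [combinedNoise, uHat_eq, map_mul, Complex.conj_ofReal, mul_assoc]

lemma finiteMoments_gain (k a : Fin K) :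
    FiniteMoments (S.gain (n := n) k a) (S.channelLaw n) := by
  rw [show S.gain (n := n) k a = _ from funext fun ω => S.gain_eq k a ω]
  exact FiniteMoments.sum _ fun m _ =>
    ((S.finiteMoments_y m k).conjugate.mul (S.finiteMoments_u m a)).const_mul _

lemma finiteMoments_combinedNoise (k : Fin K) (i : Fin n) :
    FiniteMoments (S.combinedNoise k i) (S.channelLaw n) := by
  rw [show S.combinedNoise k i = _ from funext fun ω => S.combinedNoise_eq k i ω]
  exact FiniteMoments.sum _ fun m _ =>
    ((S.finiteMoments_y m k).conjugate.mul (S.finiteMoments_dataNoise m i)).const_mul _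

lemma measurable_gain (k a : Fin K) : Measurable (S.gain (n := n) k a) := by
  rw [show S.gain (n := n) k a = _ from funext fun ω => S.gain_eq k a ω]
  have := fun m => S.measurable_u (n := n) m a
  have := fun m => S.measurable_y (n := n) m k
  fun_prop

lemma measurable_combinedNoise (k : Fin K) (i : Fin n) : Measurable (S.combinedNoise k i) := by
  rw [show S.combinedNoise k i = _ from funext fun ω => S.combinedNoise_eq k i ω]
  have := fun m => S.measurable_y (n := n) m k
  fun_prop

lemma meanGain_eq (n : ℕ) (k : Fin K) : S.meanGain n k = ((∑ m, S.γ m k : ℝ) : ℂ) := by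
  rw [meanGain]
  simp_rw [gain_eq]
  rw [integral_finsetSum _ fun m _ => (((S.finiteMoments_y m k).conjugate.mul
    (S.finiteMoments_u m k)).const_mul _).integrable]
  simp_rw [integral_const_mul, integral_conj_y_mul_u, if_pos (S.self_mem_pilotSet k)]
  push_cast
  refine Finset.sum_congr rfl fun m _ => ?_
  rw [γ]
  push_cast
  ring

/-! ### Closed forms of the noise and interference powers -/

/-- The power of a sum of terms `c_m conj(y_m) v_m` in terms of fourth moments. -/
lemma integral_norm_sq_combination (k : Fin K) (v : Fin M → ChannelSample M K N τp n → ℂ)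
    (hv : ∀ m, FiniteMoments (v m) (S.channelLaw n)) :
    ((∫ ω, ‖∑ m, (S.c m k : ℂ) * (conj (S.y m k ω) * v m ω)‖ ^ 2 ∂(S.channelLaw n) : ℝ) : ℂ) =
      ∑ m, ∑ m', (S.c m k : ℂ) * S.c m' k *
        ∫ ω, conj (S.y m k ω) * v m ω * S.y m' k ω * conj (v m' ω) ∂(S.channelLaw n) := by
  have e : ∀ ω : ChannelSample M K N τp n,
      conj (∑ m, (S.c m k : ℂ) * (conj (S.y m k ω) * v m ω)) *
        (∑ m, (S.c m k : ℂ) * (conj (S.y m k ω) * v m ω)) =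
      ∑ m, ∑ m', (S.c m k : ℂ) * S.c m' k *
        (conj (S.y m k ω) * v m ω * S.y m' k ω * conj (v m' ω)) := by
    intro ω
    rw [mul_comm, map_sum, Finset.sum_mul_sum]
    refine Finset.sum_congr rfl fun m _ => Finset.sum_congr rfl fun m' _ => ?_
    simp only [map_mul, Complex.conj_ofReal, Complex.conj_conj]
    ring
  have hi : ∀ m m', FiniteMoments (fun ω => (S.c m k : ℂ) * S.c m' k *
        (conj (S.y m k ω) * v m ω * S.y m' k ω * conj (v m' ω))) (S.channelLaw n) :=
    fun m m' => ((((S.finiteMoments_y m k).conjugate.mul (hv m)).mul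
      (S.finiteMoments_y m' k)).mul (hv m').conjugate).const_mul _
  rw [integral_ofReal_norm_sq]
  simp_rw [e]
  rw [integral_finsetSum _ fun m _ => (FiniteMoments.sum _ fun m' _ => hi m m').integrable]
  simp_rw [integral_finsetSum _ fun m' _ => (hi _ m').integrable, integral_const_mul]

/-- The data noise uses sources disjoint from those of `y`, so the only surviving Wick pairing is
the power of `y_m` times the unit noise power, at `m = m'`. Then `c² · pilotPower = γ`. -/
lemma noisePower_eq (k : Fin K) (i : Fin n) : S.noisePower k i = S.NO k := by
  rw [← Complex.ofReal_inj, noisePower]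
  simp_rw [combinedNoise_eq]
  rw [S.integral_norm_sq_combination k (fun m ω => ω.2.2.2.2 m i)
    fun m => S.finiteMoments_dataNoise m i]
  have key : ∀ m m', ∫ ω, conj (S.y m k ω) * ω.2.2.2.2 m i * S.y m' k ω * conj (ω.2.2.2.2 m' i)
      ∂(S.channelLaw n) = if m = m' then (S.pilotPower m k : ℂ) else 0 := by
    intro m m'
    rw [S.integral_channelLaw_eq ((((S.finiteMoments_y m k).conjugate.mul
      (S.finiteMoments_dataNoise m i)).mul (S.finiteMoments_y m' k)).mul
      (S.finiteMoments_dataNoise m' i).conjugate)]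
    simp_rw [y_ofSources, dataNoise_ofSources, integral_wick_dotProduct,
      star_yCoeff_dotProduct_dataNoiseCoeff, star_dataNoiseCoeff_dotProduct,
      star_yCoeff_dotProduct_yCoeff]
    split_ifs with h1 h2 h2
    · simp only [zero_mul, zero_add, mul_one]
      rw [integral_condPower]
    · exact absurd h1.symm h2
    · simp
    · simp
  simp_rw [key, mul_ite, mul_zero, Finset.sum_ite_eq, Finset.mem_univ, if_true]
  rw [NO]
  push_cast
  refine Finset.sum_congr rfl fun m _ => ?_
  rw [mul_assoc, ← Complex.ofReal_mul, c_mul_pilotPower, γ]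
  push_cast
  ring

lemma integral_fourthMoment (m m' : Fin M) (k a : Fin K) :
    ∫ ω, conj (S.y m k ω) * S.u m a ω * S.y m' k ω * conj (S.u m' a ω) ∂(S.channelLaw n) =
      S.p * τp * ((if a ∈ S.pilotSet k then (S.δ m a : ℂ) * S.δ m' a else 0) +
        ∑ b ∈ S.pilotSet k, (S.Θ m a * S.Θ m' b).trace) +
      if m = m' then (S.pilotPower m k : ℂ) * S.δ m a +
        S.p * τp * (if a ∈ S.pilotSet k then (S.Θ m a ^ 2).trace else 0) else 0 := by
  have hsq : (Real.sqrt (S.p * τp) : ℂ) * (Real.sqrt (S.p * τp) : ℂ) = S.p * τp := by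
    rw [← Complex.ofReal_mul, Real.mul_self_sqrt (mul_nonneg S.p_nonneg (Nat.cast_nonneg _))]
    simp
  rw [S.integral_channelLaw_eq ((((S.finiteMoments_y m k).conjugate.mul
    (S.finiteMoments_u m a)).mul (S.finiteMoments_y m' k)).mul (S.finiteMoments_u m' a).conjugate)]
  simp_rw [y_ofSources, u_ofSources, integral_wick_dotProduct, star_yCoeff_dotProduct_uCoeff,
    star_uCoeff_dotProduct_yCoeff, star_uCoeff_dotProduct, star_yCoeff_dotProduct_yCoeff, if_true]
  have hCC : ∀ b d : Fin K, ∀ e f : Fin K, FiniteMoments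
      (fun z => S.condCov m b d z * S.condCov m' e f z)
      (stdComplexGaussianPi (Fin K × Fin N)) :=
    fun b d e f => (S.finiteMoments_condCov m b d).mul (S.finiteMoments_condCov m' e f)
  have hsum : FiniteMoments (fun z => ∑ b ∈ S.pilotSet k, ∑ d ∈ S.pilotSet k,
      S.condCov m b a z * S.condCov m' a d z) (stdComplexGaussianPi (Fin K × Fin N)) :=
    FiniteMoments.sum _ fun b _ => FiniteMoments.sum _ fun d _ => hCC b a a d
  have hsum' : FiniteMoments (fun z => ∑ b ∈ S.pilotSet k, ∑ d ∈ S.pilotSet k,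
      S.condCov m b d z * S.condCov m' a a z) (stdComplexGaussianPi (Fin K × Fin N)) :=
    FiniteMoments.sum _ fun b _ => FiniteMoments.sum _ fun d _ => hCC b d a a
  -- First Wick pairing: `y` with `u` at each access point. It is present for all `m`, `m'`, since
  -- both covariances depend on the same `z`.
  have e1 : ∀ z, (Real.sqrt (S.p * τp) : ℂ) * (∑ b ∈ S.pilotSet k, S.condCov m b a z) *
      ((Real.sqrt (S.p * τp) : ℂ) * ∑ b ∈ S.pilotSet k, S.condCov m' a b z) =
      S.p * τp * ∑ b ∈ S.pilotSet k, ∑ d ∈ S.pilotSet k,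
        S.condCov m b a z * S.condCov m' a d z := by
    intro z
    rw [← Finset.sum_mul_sum, ← hsq]
    ring
  -- Second pairing: the conditional power of `y` times that of `u`, nonzero only for `m = m'`.
  have e2 : ∀ z, (if m = m' then ((S.p * τp : ℝ) : ℂ) * (∑ b ∈ S.pilotSet k,
      ∑ d ∈ S.pilotSet k, S.condCov m b d z) + 1 else 0) *
      (if m' = m then S.condCov m' a a z else 0) = if m = m' then
      S.p * τp * (∑ b ∈ S.pilotSet k, ∑ d ∈ S.pilotSet k,
        S.condCov m b d z * S.condCov m' a a z) + S.condCov m' a a z else 0 := by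
    intro z
    by_cases h : m = m'
    · simp only [h, if_true, ← Finset.sum_mul]
      push_cast
      ring
    · simp [h]
  simp_rw [e1, e2]
  have i1 : ∫ z, (S.p * τp * ∑ b ∈ S.pilotSet k, ∑ d ∈ S.pilotSet k,
        S.condCov m b a z * S.condCov m' a d z) ∂(stdComplexGaussianPi (Fin K × Fin N)) =
      S.p * τp * ((if a ∈ S.pilotSet k then (S.δ m a : ℂ) * S.δ m' a else 0) +
        ∑ b ∈ S.pilotSet k, (S.Θ m a * S.Θ m' b).trace) := by
    rw [integral_const_mul, integral_finsetSum _ fun b _ =>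
      (FiniteMoments.sum _ fun d _ => hCC b a a d).integrable]
    simp_rw [integral_finsetSum _ fun d _ => (hCC _ a a d).integrable,
      integral_condCov_mul_condCov, true_and, Finset.sum_add_distrib, ← Finset.mul_sum,
      ← Finset.sum_mul, Finset.sum_ite_eq, Finset.sum_ite_eq']
    congr 2
    · split_ifs <;> simp
    · exact Finset.sum_congr rfl fun b hb => if_pos hb
  have i2 : m = m' → ∫ z, (S.p * τp * (∑ b ∈ S.pilotSet k, ∑ d ∈ S.pilotSet k,
        S.condCov m b d z * S.condCov m' a a z) + S.condCov m' a a z)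
        ∂(stdComplexGaussianPi (Fin K × Fin N)) = (S.pilotPower m k : ℂ) * S.δ m a +
        S.p * τp * (if a ∈ S.pilotSet k then (S.Θ m a ^ 2).trace else 0) := by
    rintro rfl
    rw [integral_add (hsum'.const_mul _).integrable (S.finiteMoments_condCov m a a).integrable,
      integral_const_mul, integral_finsetSum _ fun b _ =>
      (FiniteMoments.sum _ fun d _ => hCC b d a a).integrable]
    simp_rw [integral_finsetSum _ fun d _ => (hCC _ d a a).integrable,
      integral_condCov_mul_condCov, integral_condCov, if_true, Finset.sum_add_distrib,
      ← Finset.sum_mul, Finset.sum_ite_eq]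
    -- The trace correction requires both users of the pair `(b, d)` to be `a`, hence `a` to share
    -- the pilot.
    have h3 : ∀ b ∈ S.pilotSet k, ∑ d ∈ S.pilotSet k,
        (if d = a ∧ b = a then (S.Θ m d * S.Θ m b).trace else 0) =
        if b = a then (if a ∈ S.pilotSet k then (S.Θ m a ^ 2).trace else 0) else 0 := by
      intro b _
      by_cases hb : b = a
      · subst hb
        simp [Finset.sum_ite_eq', pow_two]
      · simp [hb]
    rw [Finset.sum_congr rfl h3, Finset.sum_ite_eq', Finset.sum_congr rfl fun b hb => if_pos hb,
      pilotPower]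
    push_cast
    split_ifs <;> ring
  by_cases h : m = m'
  · simp only [if_pos h]
    rw [integral_add (hsum.const_mul _).integrable
      ((hsum'.const_mul _).add (S.finiteMoments_condCov m' a a)).integrable, i1, i2 h]
  · simp only [if_neg h, add_zero]
    rw [i1]

/-- Summing the fourth moments with weights `c_m c_{m'}` gives, for one user `a`, the summands of
`MI` before weighting by `ρ η_a`. The last term, the coherent one, is still present for `a = k`. -/
lemma ofReal_integral_norm_sq_gain (k a : Fin K) :
    ((∫ ω, ‖S.gain (n := n) k a ω‖ ^ 2 ∂(S.channelLaw n) : ℝ) : ℂ) =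
      (∑ m, (S.γ m k : ℂ) * S.δ m a) +
      S.p * τp * (∑ b ∈ S.pilotSet k, ∑ m, ∑ m',
        (S.c m k : ℂ) * S.c m' k * (S.Θ m a * S.Θ m' b).trace) +
      if a ∈ S.pilotSet k then S.p * τp * (∑ m, (S.c m k : ℂ) ^ 2 * (S.Θ m a ^ 2).trace) +
        S.p * τp * (∑ m, (S.c m k : ℂ) * S.δ m a) ^ 2 else 0 := by
  simp_rw [gain_eq]
  rw [S.integral_norm_sq_combination k (fun m => S.u m a) fun m => S.finiteMoments_u m a]
  simp_rw [integral_fourthMoment, mul_add, Finset.sum_add_distrib, mul_ite, mul_zero,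
    Finset.sum_ite_eq, Finset.mem_univ, if_true, mul_add, Finset.sum_add_distrib]
  have h1 : ∑ m, (S.c m k : ℂ) * S.c m k * (S.pilotPower m k * S.δ m a) =
      ∑ m, (S.γ m k : ℂ) * S.δ m a := by
    refine Finset.sum_congr rfl fun m _ => ?_
    have := S.c_mul_pilotPower m k
    rw [show (S.c m k : ℂ) * S.c m k * (S.pilotPower m k * S.δ m a) =
      S.c m k * ((S.c m k * S.pilotPower m k : ℝ) : ℂ) * S.δ m a by push_cast; ring, this, γ]
    push_cast
    ring
  have h2 : ∑ m, ∑ m', (S.c m k : ℂ) * S.c m' k * (S.p * τp *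
      ∑ b ∈ S.pilotSet k, (S.Θ m a * S.Θ m' b).trace) =
      S.p * τp * (∑ b ∈ S.pilotSet k, ∑ m, ∑ m',
        (S.c m k : ℂ) * S.c m' k * (S.Θ m a * S.Θ m' b).trace) := by
    simp_rw [Finset.mul_sum]
    rw [Finset.sum_comm (s := S.pilotSet k)]
    refine Finset.sum_congr rfl fun m _ => ?_
    rw [Finset.sum_comm (s := S.pilotSet k)]
    exact Finset.sum_congr rfl fun m' _ => Finset.sum_congr rfl fun b _ => by ring
  rw [h1, h2]
  by_cases ha : a ∈ S.pilotSet k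
  · simp only [if_pos ha]
    have h3 : S.p * τp * (∑ m, (S.c m k : ℂ) * S.δ m a) ^ 2 = ∑ m, ∑ m',
        (S.c m k : ℂ) * S.c m' k * (S.p * τp * (S.δ m a * S.δ m' a)) := by
      rw [pow_two, Finset.sum_mul_sum, Finset.mul_sum]
      refine Finset.sum_congr rfl fun m _ => ?_
      rw [Finset.mul_sum]
      exact Finset.sum_congr rfl fun m' _ => by ring
    have h4 : S.p * τp * (∑ m, (S.c m k : ℂ) ^ 2 * (S.Θ m a ^ 2).trace) =
        ∑ m, (S.c m k : ℂ) * S.c m k * (S.p * τp * (S.Θ m a ^ 2).trace) := by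
      rw [Finset.mul_sum]
      exact Finset.sum_congr rfl fun m' _ => by ring
    rw [h3, h4]
    ring
  · simp [ha]
    ring

lemma integral_norm_sub_integral_sq {Ω : Type*} [MeasurableSpace Ω] {μ : Measure Ω}
    [IsProbabilityMeasure μ] {f : Ω → ℂ} (hf : MemLp f 2 μ) :
    ∫ ω, ‖f ω - ∫ x, f x ∂μ‖ ^ 2 ∂μ = ∫ ω, ‖f ω‖ ^ 2 ∂μ - ‖∫ x, f x ∂μ‖ ^ 2 := by
  set c := ∫ x, f x ∂μ with hc
  have h1 : Integrable f μ := hf.integrable (by norm_num)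
  have h2 : Integrable (fun ω => ‖f ω‖ ^ 2) μ := hf.integrable_norm_pow (by norm_num)
  have e : ∀ ω, ‖f ω - c‖ ^ 2 = ‖f ω‖ ^ 2 - 2 * (conj c * f ω).re + ‖c‖ ^ 2 := by
    intro ω
    simp only [Complex.sq_norm, Complex.normSq_apply, Complex.sub_re, Complex.sub_im,
      Complex.mul_re, Complex.conj_re, Complex.conj_im]
    ring
  have h3 : Integrable (fun ω => 2 * (conj c * f ω).re) μ := (h1.const_mul _).re.const_mul 2
  have h4 : ∫ ω, (conj c * f ω).re ∂μ = ‖c‖ ^ 2 := by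
    have := integral_re (𝕜 := ℂ) (h1.const_mul (conj c))
    simp only [RCLike.re_to_complex] at this
    rw [this, integral_const_mul, ← hc, Complex.conj_mul']
    norm_cast
  have h5 : Integrable (fun ω => ‖f ω‖ ^ 2 - 2 * (conj c * f ω).re) μ := h2.sub h3
  simp_rw [e]
  rw [integral_add h5 (integrable_const _), integral_sub h2 h3, integral_const_mul, h4]
  simp
  ring

/-- The variance of the gain of user `k` is its power minus its squared mean, so the interference is
the total signal power minus the useful power. -/
lemma interferencePower_eq_sub (n : ℕ) (k : Fin K) :
    S.interferencePower n k =
      S.ρ * (∑ a, S.η a * ∫ ω, ‖S.gain (n := n) k a ω‖ ^ 2 ∂(S.channelLaw n)) -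
        S.ρ * S.η k * (∑ m, S.γ m k) ^ 2 := by
  have h := integral_norm_sub_integral_sq (S.finiteMoments_gain (n := n) k k).memLp_two
  have h5 : ‖S.meanGain n k‖ ^ 2 = (∑ m, S.γ m k) ^ 2 := by
    rw [meanGain_eq, Complex.norm_real, Real.norm_eq_abs, sq_abs]
  rw [← Finset.add_sum_erase _ _ (Finset.mem_univ k), interferencePower, ← h5]
  rw [meanGain, h]
  ring

/-- The closed form of the interference power. -/
lemma interferencePower_eq_MI (n : ℕ) (k : Fin K) :
    ((S.interferencePower n k : ℝ) : ℂ) = S.MI k := by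
  rw [interferencePower_eq_sub]
  simp only [Complex.ofReal_sub, Complex.ofReal_mul, Complex.ofReal_sum,
    ofReal_integral_norm_sq_gain, Complex.ofReal_pow]
  -- For user `k` the coherent term is the squared mean gain, since `√(p τp) c δ = γ`. It cancels
  -- against the subtracted useful power, which is why the last sum of `MI` omits `k`.
  have hk : S.p * τp * (∑ m, (S.c m k : ℂ) * S.δ m k) ^ 2 = (∑ m, (S.γ m k : ℂ)) ^ 2 := by
    have hsq : (Real.sqrt (S.p * τp) : ℂ) ^ 2 = S.p * τp := by
      rw [← Complex.ofReal_pow, Real.sq_sqrt (mul_nonneg S.p_nonneg (Nat.cast_nonneg _))]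
      simp
    rw [← hsq, ← mul_pow, Finset.mul_sum]
    congr 1
    refine Finset.sum_congr rfl fun m _ => ?_
    rw [γ]
    push_cast
    ring
  have hP : ∀ F : Fin K → ℂ, ∑ a, (S.η a : ℂ) * (if a ∈ S.pilotSet k then F a else 0) =
      ∑ a ∈ S.pilotSet k, (S.η a : ℂ) * F a := by
    intro F
    simp_rw [mul_ite, mul_zero]
    rw [Finset.sum_ite_mem, Finset.univ_inter]
  simp_rw [mul_add (S.η _ : ℂ), Finset.sum_add_distrib]
  rw [hP]
  simp_rw [mul_add (S.η _ : ℂ), Finset.sum_add_distrib]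
  have s1 : ∑ a, (S.η a : ℂ) * ∑ m, (S.γ m k : ℂ) * S.δ m a =
      ∑ a, ∑ m, (S.η a : ℂ) * S.γ m k * S.δ m a := by
    simp_rw [Finset.mul_sum, mul_assoc]
  have s2 : ∑ a ∈ S.pilotSet k, (S.η a : ℂ) *
      (S.p * τp * ∑ m, (S.c m k : ℂ) ^ 2 * (S.Θ m a ^ 2).trace) =
      S.p * τp * ∑ a ∈ S.pilotSet k, ∑ m, (S.η a : ℂ) * S.c m k ^ 2 * (S.Θ m a ^ 2).trace := by
    rw [Finset.mul_sum]
    refine Finset.sum_congr rfl fun a _ => ?_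
    rw [mul_left_comm, Finset.mul_sum]
    simp_rw [mul_assoc]
  have s3 : ∑ a, (S.η a : ℂ) * (S.p * τp * ∑ b ∈ S.pilotSet k, ∑ m, ∑ m',
        (S.c m k : ℂ) * S.c m' k * (S.Θ m a * S.Θ m' b).trace) =
      S.p * τp * ∑ a, ∑ b ∈ S.pilotSet k, ∑ m, ∑ m',
        (S.η a : ℂ) * S.c m k * S.c m' k * (S.Θ m a * S.Θ m' b).trace := by
    rw [Finset.mul_sum]
    refine Finset.sum_congr rfl fun a _ => ?_
    rw [mul_left_comm]
    simp_rw [Finset.mul_sum, mul_assoc]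
  have s4 : ∑ a ∈ S.pilotSet k, (S.η a : ℂ) * (S.p * τp * (∑ m, (S.c m k : ℂ) * S.δ m a) ^ 2) =
      S.η k * (∑ m, (S.γ m k : ℂ)) ^ 2 + S.p * τp * ∑ a ∈ (S.pilotSet k).erase k,
        (S.η a : ℂ) * (∑ m, (S.c m k : ℂ) * S.δ m a) ^ 2 := by
    rw [← Finset.add_sum_erase _ _ (S.self_mem_pilotSet k), hk, Finset.mul_sum]
    congr 1
    exact Finset.sum_congr rfl fun a _ => by ring
  rw [s1, s2, s3, s4, MI]
  ring

lemma interferencePower_nonneg (n : ℕ) (k : Fin K) : 0 ≤ S.interferencePower n k := by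
  have h := S.ρ_nonneg
  have hη := S.η_nonneg
  exact add_nonneg (mul_nonneg (mul_nonneg h (hη k)) (integral_nonneg fun _ => by positivity))
    (mul_nonneg h (Finset.sum_nonneg fun a _ => mul_nonneg (hη a)
      (integral_nonneg fun _ => by positivity)))

end RISSystem

/-! ### A variational lower bound on the Kullback-Leibler divergence -/

/-- Gibbs' inequality: tilting `ν` by `f` gives a probability measure, and the divergence of `μ`
from it is the divergence from `ν` minus `∫ f ∂μ` plus `log ∫ exp f ∂ν = 0`. It is nonnegative.
Where absolute continuity or integrability of the log-likelihood ratio fails, the divergence is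
infinite. -/
lemma ofReal_integral_le_klDiv {α : Type*} [MeasurableSpace α] {μ ν : Measure α}
    [IsProbabilityMeasure μ] [IsProbabilityMeasure ν] {f : α → ℝ} (hfμ : Integrable f μ)
    (hfν : Integrable (fun x => Real.exp (f x)) ν) (h1 : ∫ x, Real.exp (f x) ∂ν = 1) :
    ENNReal.ofReal (∫ x, f x ∂μ) ≤ InformationTheory.klDiv μ ν := by
  by_cases hac : μ ≪ ν
  · by_cases hint : Integrable (llr μ ν) μ
    · have hprob : IsProbabilityMeasure (ν.tilted f) := isProbabilityMeasure_tilted hfν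
      have hac' : μ ≪ ν.tilted f := hac.trans (absolutelyContinuous_tilted hfν)
      have h2 := InformationTheory.integral_llr_add_sub_measure_univ_nonneg hac'
        (integrable_llr_tilted_right hac hfμ hint hfν)
      rw [integral_llr_tilted_right hac hfμ hfν hint, h1] at h2
      rw [InformationTheory.klDiv_of_ac_of_integrable hac hint]
      refine ENNReal.ofReal_le_ofReal ?_
      simp at h2 ⊢
      exact h2
    · rw [InformationTheory.klDiv_of_not_integrable hint]
      exact le_top
  · rw [InformationTheory.klDiv_of_not_ac hac]
    exact le_top

/-! ### The Gaussian test channel -/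

/-- Multiplying by the density `π^(-1/2) exp(-s²)` and completing the square leaves a Gaussian
centred at `a r / (a² + v)` with exponent `-((a² + v)/v)(s - a r/(a² + v))²`. The term `r²/(a² + v)`
cancels the remainder. -/
lemma integral_exp_quadratic_gaussianReal (a r : ℝ) {v : ℝ} (hv : 0 < v) :
    ∫ s, Real.exp (r ^ 2 / (a ^ 2 + v) - (r - a * s) ^ 2 / v) ∂(gaussianReal 0 (1 / 2)) =
      Real.sqrt (v / (a ^ 2 + v)) := by
  have hav : 0 < a ^ 2 + v := by positivity
  rw [integral_gaussianReal_eq_integral_smul (by norm_num)]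
  have e : ∀ s : ℝ, gaussianPDFReal 0 (1 / 2) s •
      Real.exp (r ^ 2 / (a ^ 2 + v) - (r - a * s) ^ 2 / v) =
      (Real.sqrt Real.pi)⁻¹ * Real.exp (-((a ^ 2 + v) / v) * (s - a * r / (a ^ 2 + v)) ^ 2) := by
    intro s
    rw [gaussianPDFReal, smul_eq_mul, mul_assoc, ← Real.exp_add]
    congr 2
    · congr 1
      push_cast
      ring
    · push_cast
      field_simp
      ring
  simp_rw [e]
  rw [integral_const_mul, integral_sub_right_eq_self
    (fun s : ℝ => Real.exp (-((a ^ 2 + v) / v) * s ^ 2)), integral_gaussian, ← Real.sqrt_inv,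
    ← Real.sqrt_mul (inv_nonneg.2 Real.pi_pos.le)]
  congr 1
  have := Real.pi_pos
  field_simp

/-- Log-likelihood ratio of the conditional and the marginal output laws of a Gaussian channel with
gain `a`, noise power `v` and input `CN(0,1)`. -/
noncomputable def gaussianInfoDensity (a v : ℝ) (s r : ℂ) : ℝ :=
  Real.log ((a ^ 2 + v) / v) + ‖r‖ ^ 2 / (a ^ 2 + v) - ‖r - a * s‖ ^ 2 / v

lemma continuous_gaussianInfoDensity (a v : ℝ) :
    Continuous (fun q : ℂ × ℂ => gaussianInfoDensity a v q.1 q.2) := by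
  unfold gaussianInfoDensity
  fun_prop

/-- For fixed `r`, the only dependence on `s` is through a subtracted square, so the integrand is
bounded. -/
lemma integrable_exp_gaussianInfoDensity (a : ℝ) {v : ℝ} (hv : 0 < v) (r : ℂ) :
    Integrable (fun s => Real.exp (gaussianInfoDensity a v s r)) stdComplexGaussian := by
  refine Integrable.of_bound (C := Real.exp (Real.log ((a ^ 2 + v) / v) + ‖r‖ ^ 2 / (a ^ 2 + v)))
    ?_ (Filter.Eventually.of_forall fun s => ?_)
  · have := continuous_gaussianInfoDensity a v
    exact (Real.continuous_exp.comp (this.comp (by fun_prop : Continuous fun s : ℂ => (s, r)))).aestronglyMeasurable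
  · rw [Real.norm_eq_abs, Real.abs_exp, Real.exp_le_exp, gaussianInfoDensity]
    have : 0 ≤ ‖r - a * s‖ ^ 2 / v := by positivity
    linarith

/-- Bayes' rule for the test channel: the integrand is the posterior density of `s` relative to its
prior. Analytically, real and imaginary parts each contribute `√(v/(a² + v))`, cancelling the
prefactor. -/
lemma integral_exp_gaussianInfoDensity (a : ℝ) {v : ℝ} (hv : 0 < v) (r : ℂ) :
    ∫ s, Real.exp (gaussianInfoDensity a v s r) ∂stdComplexGaussian = 1 := by
  have hav : 0 < a ^ 2 + v := by positivity
  have hm := (integrable_exp_gaussianInfoDensity a hv r).aestronglyMeasurable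
  rw [stdComplexGaussian, integral_map continuous_complex_mk.aemeasurable hm]
  have e : ∀ x : ℝ × ℝ, Real.exp (gaussianInfoDensity a v ⟨x.1, x.2⟩ r) =
      (a ^ 2 + v) / v * (Real.exp (r.re ^ 2 / (a ^ 2 + v) - (r.re - a * x.1) ^ 2 / v) *
        Real.exp (r.im ^ 2 / (a ^ 2 + v) - (r.im - a * x.2) ^ 2 / v)) := by
    intro x
    rw [gaussianInfoDensity, add_sub_assoc, Real.exp_add, Real.exp_log (by positivity),
      ← Real.exp_add]
    congr 2
    simp only [Complex.sq_norm, Complex.normSq_apply, Complex.sub_re, Complex.sub_im,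
      Complex.mul_re, Complex.mul_im, Complex.ofReal_re, Complex.ofReal_im]
    ring
  simp_rw [e]
  rw [integral_const_mul, integral_prod_mul
      (fun x : ℝ => Real.exp (r.re ^ 2 / (a ^ 2 + v) - (r.re - a * x) ^ 2 / v))
      (fun x : ℝ => Real.exp (r.im ^ 2 / (a ^ 2 + v) - (r.im - a * x) ^ 2 / v)),
    integral_exp_quadratic_gaussianReal a _ hv, integral_exp_quadratic_gaussianReal a _ hv,
    Real.mul_self_sqrt (by positivity)]
  field_simp

/-- The information that a channel output `Y` carries on a Gaussian input block `X` is at least that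
of the Gaussian channel with the same gain and noise power. -/
lemma ofReal_log_le_mutualInfo {Ω ι : Type*} [MeasurableSpace Ω] [Fintype ι] {P : Measure Ω}
    [IsProbabilityMeasure P] {X Y : Ω → ι → ℂ} (hX : Measurable X) (hY : Measurable Y)
    (hlaw : P.map X = stdComplexGaussianPi ι) {a v : ℝ} (hv : 0 < v)
    (hY2 : ∀ i, MemLp (fun ω => Y ω i) 2 P) (hX2 : ∀ i, MemLp (fun ω => X ω i) 2 P)
    (hpow : ∀ i, ∫ ω, ‖Y ω i‖ ^ 2 ∂P = a ^ 2 + v)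
    (herr : ∀ i, ∫ ω, ‖Y ω i - a * X ω i‖ ^ 2 ∂P = v) :
    ENNReal.ofReal (Fintype.card ι * Real.log ((a ^ 2 + v) / v)) ≤ mutualInfo P X Y := by
  have hav : 0 < a ^ 2 + v := by positivity
  have hXY : Measurable fun ω => (X ω, Y ω) := hX.prodMk hY
  have : IsProbabilityMeasure (P.map X) := Measure.isProbabilityMeasure_map hX.aemeasurable
  have : IsProbabilityMeasure (P.map Y) := Measure.isProbabilityMeasure_map hY.aemeasurable
  have : IsProbabilityMeasure (P.map fun ω => (X ω, Y ω)) :=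
    Measure.isProbabilityMeasure_map hXY.aemeasurable
  set f : (ι → ℂ) × (ι → ℂ) → ℝ := fun q => ∑ i, gaussianInfoDensity a v (q.1 i) (q.2 i) with hf
  have hfc : Continuous f := continuous_finsetSum _ fun i _ =>
    (continuous_gaussianInfoDensity a v).comp (by fun_prop : Continuous
      fun q : (ι → ℂ) × (ι → ℂ) => (q.1 i, q.2 i))
  have j1 : ∀ i, Integrable (fun ω => ‖Y ω i‖ ^ 2) P :=
    fun i => (hY2 i).integrable_norm_pow (by norm_num)
  have j2 : ∀ i, Integrable (fun ω => ‖Y ω i - a * X ω i‖ ^ 2) P :=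
    fun i => ((hY2 i).sub ((hX2 i).const_mul (a : ℂ))).integrable_norm_pow (by norm_num)
  have j3 : ∀ i, Integrable (fun ω => Real.log ((a ^ 2 + v) / v) + ‖Y ω i‖ ^ 2 / (a ^ 2 + v)) P :=
    fun i => (integrable_const _).add ((j1 i).div_const _)
  have j4 : ∀ i, Integrable (fun ω => gaussianInfoDensity a v (X ω i) (Y ω i)) P :=
    fun i => (j3 i).sub ((j2 i).div_const v)
  have hfint : Integrable (fun ω => f (X ω, Y ω)) P := integrable_finsetSum _ fun i _ => j4 i
  -- By the prescribed powers, the two quadratic terms of each density have mean one and cancel.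
  -- Only second moments per symbol enter, so dependence between the outputs of a block is harmless.
  have hval : ∫ q, f q ∂(P.map fun ω => (X ω, Y ω)) =
      Fintype.card ι * Real.log ((a ^ 2 + v) / v) := by
    rw [integral_map hXY.aemeasurable hfc.aestronglyMeasurable]
    simp only [hf]
    rw [integral_finsetSum _ fun i _ => j4 i]
    have : ∀ i, ∫ ω, gaussianInfoDensity a v (X ω i) (Y ω i) ∂P =
        Real.log ((a ^ 2 + v) / v) := by
      intro i
      simp only [gaussianInfoDensity]
      rw [integral_sub (j3 i) ((j2 i).div_const v),
        integral_add (integrable_const _) ((j1 i).div_const _), integral_div, integral_div,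
        hpow, herr, div_self hav.ne', div_self hv.ne']
      simp
    simp [this]
  -- Normalization holds for every fixed output block, so nothing need be known about the law of
  -- `Y`. The i.i.d. input makes the integral factor over the symbols.
  have hsec : ∀ y : ι → ℂ, Integrable (fun x => Real.exp (f (x, y))) (stdComplexGaussianPi ι) ∧
      ∫ x, Real.exp (f (x, y)) ∂(stdComplexGaussianPi ι) = 1 := by
    intro y
    have e : (fun x : ι → ℂ => Real.exp (f (x, y))) =
        fun x => ∏ i, Real.exp (gaussianInfoDensity a v (x i) (y i)) := by
      ext x
      rw [hf, Real.exp_sum]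
    rw [e]
    refine ⟨Integrable.fintype_prod fun i => integrable_exp_gaussianInfoDensity a hv (y i), ?_⟩
    rw [integral_fintype_prod_eq_prod (fun i x => Real.exp (gaussianInfoDensity a v x (y i)))]
    exact Finset.prod_eq_one fun i _ => integral_exp_gaussianInfoDensity a hv (y i)
  have hsec' : ∀ y : ι → ℂ, ∫ x, Real.exp (f (x, y)) ∂(stdComplexGaussianPi ι) = 1 :=
    fun y => (hsec y).2
  have hfexp : Integrable (fun q => Real.exp (f q)) ((P.map X).prod (P.map Y)) := by
    rw [hlaw]
    refine (integrable_prod_iff' (f := fun q => Real.exp (f q))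
      (Real.continuous_exp.comp hfc).aestronglyMeasurable).2
      ⟨Filter.Eventually.of_forall fun y => (hsec y).1, ?_⟩
    simp only [Real.norm_eq_abs, Real.abs_exp, hsec']
    exact integrable_const _
  rw [← hval]
  refine ofReal_integral_le_klDiv
    ((integrable_map_measure hfc.aestronglyMeasurable hXY.aemeasurable).2 hfint) hfexp ?_
  have hone : ∫ y, ∫ x, Real.exp (f (x, y)) ∂(P.map X) ∂(P.map Y) = 1 := by
    rw [hlaw]
    simp [hsec']
  rw [integral_prod_symm _ hfexp]
  exact hone

/-! ### Powers of sums of independent signals -/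

lemma MeasureTheory.MemLp.mul_prod_two {Ω Ω' : Type*} [MeasurableSpace Ω] [MeasurableSpace Ω']
    {μ : Measure Ω} {ν : Measure Ω'} [SFinite μ] [SFinite ν] {f : Ω → ℂ} {g : Ω' → ℂ}
    (hf : MemLp f 2 μ) (hg : MemLp g 2 ν) :
    MemLp (fun q : Ω × Ω' => f q.1 * g q.2) 2 (μ.prod ν) := by
  refine (memLp_two_iff_integrable_sq_norm
    (f := fun q : Ω × Ω' => f q.1 * g q.2) (hf.1.comp_fst.mul hg.1.comp_snd)).2 ?_
  have h := (hf.integrable_norm_pow (p := 2) (by norm_num)).mul_prod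
    (hg.integrable_norm_pow (p := 2) (by norm_num))
  refine h.congr (Filter.Eventually.of_forall fun q => ?_)
  simp [mul_pow]

/-- Pythagoras with random coefficients. The `b i` may be correlated with each other: the cross
terms vanish through the factors `s i`, which live on the independent space. -/
lemma integral_norm_sq_sum_mul_of_orthonormal {Ω Ω' ι : Type*} [MeasurableSpace Ω]
    [MeasurableSpace Ω'] [Fintype ι] {μ : Measure Ω} {ν : Measure Ω'} [SFinite μ] [SFinite ν]
    {b : ι → Ω → ℂ} {s : ι → Ω' → ℂ} (hb : ∀ i, MemLp (b i) 2 μ) (hs : ∀ i, MemLp (s i) 2 ν)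
    (hone : ∀ i, ∫ x, ‖s i x‖ ^ 2 ∂ν = 1)
    (horth : ∀ i j, i ≠ j → ∫ x, conj (s i x) * s j x ∂ν = 0) :
    ∫ q, ‖∑ i, b i q.1 * s i q.2‖ ^ 2 ∂(μ.prod ν) = ∑ i, ∫ ω, ‖b i ω‖ ^ 2 ∂μ := by
  classical
  rw [← Complex.ofReal_inj, RISSystem.integral_ofReal_norm_sq]
  have e : ∀ q : Ω × Ω', conj (∑ i, b i q.1 * s i q.2) * (∑ i, b i q.1 * s i q.2) =
      ∑ i, ∑ j, (conj (b i q.1) * b j q.1) * (conj (s i q.2) * s j q.2) := by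
    intro q
    rw [map_sum, Finset.sum_mul_sum]
    exact Finset.sum_congr rfl fun i _ => Finset.sum_congr rfl fun j _ => by
      rw [map_mul]
      ring
  have hint : ∀ i j, Integrable (fun q : Ω × Ω' => (conj (b i q.1) * b j q.1) *
      (conj (s i q.2) * s j q.2)) (μ.prod ν) := fun i j =>
    Integrable.mul_prod (f := fun ω => conj (b i ω) * b j ω)
      (g := fun x => conj (s i x) * s j x) ((hb i).star.integrable_mul (hb j))
      ((hs i).star.integrable_mul (hs j))
  simp_rw [e]
  rw [integral_finsetSum _ fun i _ => integrable_finsetSum _ fun j _ => hint i j, Complex.ofReal_sum]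
  refine Finset.sum_congr rfl fun i _ => ?_
  rw [integral_finsetSum _ fun j _ => hint i j, Finset.sum_eq_single i]
  · rw [integral_prod_mul (fun ω => conj (b i ω) * b i ω) (fun x => conj (s i x) * s i x),
      ← RISSystem.integral_ofReal_norm_sq, ← RISSystem.integral_ofReal_norm_sq, hone]
    simp
  · intro j _ hj
    rw [integral_prod_mul (fun ω => conj (b i ω) * b j ω) (fun x => conj (s i x) * s j x),
      horth i j (Ne.symm hj), mul_zero]
  · simp

namespace RISSystem

variable {M K N τp n : ℕ} (S : RISSystem M K N τp)

/-! ### The decision statistic as a sum of orthogonal signals -/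

/-- The amplitude of the symbols of user `a`. -/
noncomputable def amplitude (a : Fin K) : ℝ := Real.sqrt S.ρ * Real.sqrt (S.η a)

lemma amplitude_sq (a : Fin K) : S.amplitude a ^ 2 = S.ρ * S.η a := by
  rw [amplitude, mul_pow, Real.sq_sqrt S.ρ_nonneg, Real.sq_sqrt (S.η_nonneg a)]

lemma decision_eq (k : Fin K) (ω : ChannelSample M K N τp n) (s : Fin K → Fin n → ℂ) (i : Fin n) :
    S.decision k ω s i =
      S.combinedNoise k i ω + ∑ a, (S.amplitude a : ℂ) * S.gain k a ω * s a i := by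
  simp only [decision, dataSignal, combinedNoise, gain, amplitude, mul_add,
    Finset.sum_add_distrib, Finset.mul_sum, Finset.sum_mul]
  rw [add_comm, Finset.sum_comm]
  congr 1
  refine Finset.sum_congr rfl fun a _ => Finset.sum_congr rfl fun m _ => ?_
  push_cast
  ring

/-- Coefficients of the noise and of the symbols in the decision statistic, minus `d` times the
symbol of user `k`. -/
noncomputable def decisionCoeff (k : Fin K) (i : Fin n) (d : ℂ) :
    Option (Fin K) → ChannelSample M K N τp n → ℂ
  | none => S.combinedNoise k i
  | some a => fun ω => (S.amplitude a : ℂ) * S.gain k a ω - if a = k then d else 0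

/-- The `i`-th symbols of all users, together with the constant `1`. -/
def symbol (i : Fin n) : Option (Fin K) → (Fin K → Fin n → ℂ) → ℂ
  | none => 1
  | some a => fun s => s a i

lemma decision_sub_eq (k : Fin K) (ω : ChannelSample M K N τp n) (s : Fin K → Fin n → ℂ)
    (i : Fin n) (d : ℂ) :
    S.decision k ω s i - d * s k i = ∑ o, S.decisionCoeff k i d o ω * symbol i o s := by
  rw [decision_eq, Fintype.sum_option]
  simp only [decisionCoeff, symbol, Pi.one_apply, mul_one, sub_mul, Finset.sum_sub_distrib,
    ite_mul, zero_mul, Finset.sum_ite_eq', Finset.mem_univ, if_true]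
  ring

lemma memLp_decisionCoeff (k : Fin K) (i : Fin n) (d : ℂ) (o : Option (Fin K)) :
    MemLp (S.decisionCoeff k i d o) 2 (S.channelLaw n) := by
  cases o with
  | none => exact (S.finiteMoments_combinedNoise k i).memLp_two
  | some a => exact ((S.finiteMoments_gain k a).memLp_two.const_mul _).sub (memLp_const _)

section Symbols

variable {Q : Fin K → Measure (Fin n → ℂ)} (hQ : ∀ a, AdmissibleSymbols (Q a))
include hQ

lemma memLp_symbol (i : Fin n) (o : Option (Fin K)) : MemLp (symbol i o) 2 (Measure.pi Q) := by
  have := fun a => (hQ a).1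
  cases o with
  | none => exact memLp_const 1
  | some a => exact ((hQ a).2 i).1.comp_measurePreserving (measurePreserving_eval Q a)

lemma integral_norm_sq_symbol (i : Fin n) (o : Option (Fin K)) :
    ∫ s, ‖symbol i o s‖ ^ 2 ∂(Measure.pi Q) = 1 := by
  have := fun a => (hQ a).1
  cases o with
  | none => simp [symbol]
  | some a =>
    exact (integral_comp_eval (μ := Q) (i := a) (f := fun x : Fin n → ℂ => ‖x i‖ ^ 2)
      ((measurable_pi_apply i).norm.pow_const 2).aestronglyMeasurable).trans ((hQ a).2 i).2.2

lemma integral_symbol_some (i : Fin n) (a : Fin K) :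
    ∫ s, symbol i (some a) s ∂(Measure.pi Q) = 0 := by
  have := fun a => (hQ a).1
  exact (integral_comp_eval (μ := Q) (i := a) (f := fun x : Fin n → ℂ => x i)
    (measurable_pi_apply i).aestronglyMeasurable).trans ((hQ a).2 i).2.1

/-- Orthogonality to the constant `1` is the zero mean; two users' symbols are orthogonal by
independence and zero mean. -/
lemma integral_conj_symbol_mul_symbol (i : Fin n) {o o' : Option (Fin K)} (h : o ≠ o') :
    ∫ s, conj (symbol i o s) * symbol i o' s ∂(Measure.pi Q) = 0 := by
  have := fun a => (hQ a).1
  have h0 := integral_symbol_some hQ i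
  have h1 : ∀ a, ∫ s, conj (symbol i (some a) s) ∂(Measure.pi Q) = 0 := fun a => by
    rw [integral_conj, h0, map_zero]
  cases o with
  | none =>
    cases o' with
    | none => exact absurd rfl h
    | some b => simpa [symbol] using h0 b
  | some a =>
    cases o' with
    | none => simpa [symbol] using h1 a
    | some b =>
      have hab : a ≠ b := fun e => h (congrArg some e)
      have hind : IndepFun (fun s : Fin K → Fin n → ℂ => s a) (fun s => s b) (Measure.pi Q) :=
        (iIndepFun_pi (X := fun _ (x : Fin n → ℂ) => x) (μ := Q)
          fun _ => aemeasurable_id).indepFun hab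
      have hi : Measurable fun x : Fin n → ℂ => x i := measurable_pi_apply i
      have hind2 := hind.comp (φ := fun x : Fin n → ℂ => conj (x i)) (ψ := fun x : Fin n → ℂ => x i)
        (Complex.continuous_conj.measurable.comp hi) hi
      have := hind2.integral_fun_mul_eq_mul_integral
        ((Complex.continuous_conj.measurable.comp hi).comp
          (measurable_pi_apply a)).aestronglyMeasurable
        (hi.comp (measurable_pi_apply b)).aestronglyMeasurable
      refine this.trans ?_
      rw [show ∫ s, ((fun x : Fin n → ℂ => x i) ∘ fun s : Fin K → Fin n → ℂ => s b) s
        ∂(Measure.pi Q) = 0 from h0 b, mul_zero]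

lemma integral_norm_sq_decision_sub (k : Fin K) (i : Fin n) (d : ℂ) :
    ∫ q, ‖S.decision k q.1 q.2 i - d * q.2 k i‖ ^ 2 ∂((S.channelLaw n).prod (Measure.pi Q)) =
      S.noisePower k i + ∑ a, ∫ ω, ‖(S.amplitude a : ℂ) * S.gain k a ω - if a = k then d else 0‖ ^ 2
        ∂(S.channelLaw n) := by
  have := fun a => (hQ a).1
  simp_rw [decision_sub_eq]
  rw [integral_norm_sq_sum_mul_of_orthonormal (S.memLp_decisionCoeff k i d) (memLp_symbol hQ i)
    (integral_norm_sq_symbol hQ i) fun o o' h => integral_conj_symbol_mul_symbol hQ i h,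
    Fintype.sum_option]
  rfl

lemma memLp_decision (k : Fin K) (i : Fin n) :
    MemLp (fun q : ChannelSample M K N τp n × (Fin K → Fin n → ℂ) => S.decision k q.1 q.2 i) 2
      ((S.channelLaw n).prod (Measure.pi Q)) := by
  have := fun a => (hQ a).1
  have e : ∀ q : ChannelSample M K N τp n × (Fin K → Fin n → ℂ), S.decision k q.1 q.2 i =
      ∑ o, S.decisionCoeff k i 0 o q.1 * symbol i o q.2 := fun q => by
    rw [← decision_sub_eq]
    simp
  simp_rw [e]
  exact memLp_finsetSum _ fun o _ => (S.memLp_decisionCoeff k i 0 o).mul_prod_two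
    (memLp_symbol hQ i o)

/-- The case `d = 0`: the total signal power splits into the useful power and the interference. -/
lemma integral_norm_sq_decision (k : Fin K) (i : Fin n) :
    ∫ q, ‖S.decision k q.1 q.2 i‖ ^ 2 ∂((S.channelLaw n).prod (Measure.pi Q)) =
      (S.amplitude k * ∑ m, S.γ m k) ^ 2 + (S.interferencePower n k + S.NO k) := by
  have h := S.integral_norm_sq_decision_sub hQ k i 0
  simp only [zero_mul, sub_zero, ite_self, norm_mul, mul_pow, Complex.norm_real, Real.norm_eq_abs,
    sq_abs, integral_const_mul, amplitude_sq] at h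
  rw [h, noisePower_eq, interferencePower_eq_sub, mul_pow, amplitude_sq, Finset.mul_sum]
  simp_rw [mul_assoc]
  ring

/-- Subtracting the mean gain replaces the coefficient of user `k` by its fluctuation and leaves the
other users and the noise unchanged. -/
lemma integral_norm_sq_decision_sub_mean (k : Fin K) (i : Fin n) :
    ∫ q, ‖S.decision k q.1 q.2 i - ((S.amplitude k * ∑ m, S.γ m k : ℝ) : ℂ) * q.2 k i‖ ^ 2
      ∂((S.channelLaw n).prod (Measure.pi Q)) = S.interferencePower n k + S.NO k := by
  have h := S.integral_norm_sq_decision_sub hQ k i ((S.amplitude k * ∑ m, S.γ m k : ℝ) : ℂ)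
  have h1 : ∫ ω, ‖(S.amplitude k : ℂ) * S.gain k k ω -
      ((S.amplitude k * ∑ m, S.γ m k : ℝ) : ℂ)‖ ^ 2 ∂(S.channelLaw n) =
      S.ρ * S.η k * ∫ ω, ‖S.gain k k ω - S.meanGain n k‖ ^ 2 ∂(S.channelLaw n) := by
    rw [← integral_const_mul]
    congr 1 with ω
    rw [Complex.ofReal_mul, ← S.meanGain_eq n, ← mul_sub, norm_mul, mul_pow, Complex.norm_real,
      Real.norm_eq_abs, sq_abs, amplitude_sq]
  have h2 : ∑ a ∈ Finset.univ.erase k, ∫ ω, ‖(S.amplitude a : ℂ) * S.gain k a ω -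
      (if a = k then ((S.amplitude k * ∑ m, S.γ m k : ℝ) : ℂ) else 0)‖ ^ 2 ∂(S.channelLaw n) =
      S.ρ * ∑ a ∈ Finset.univ.erase k, S.η a * ∫ ω, ‖S.gain k a ω‖ ^ 2 ∂(S.channelLaw n) := by
    rw [Finset.mul_sum (Finset.univ.erase k)]
    refine Finset.sum_congr rfl fun a ha => ?_
    rw [if_neg (Finset.ne_of_mem_erase ha), ← mul_assoc, ← integral_const_mul]
    congr 1 with ω
    rw [sub_zero, norm_mul, mul_pow, Complex.norm_real, Real.norm_eq_abs, sq_abs, amplitude_sq]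
  rw [h, noisePower_eq, ← Finset.add_sum_erase _ _ (Finset.mem_univ k), h2, if_pos rfl, h1,
    interferencePower]
  ring

end Symbols

lemma measurable_decision (k : Fin K) :
    Measurable (fun q : ChannelSample M K N τp n × (Fin K → Fin n → ℂ) =>
      S.decision k q.1 q.2) := by
  have h1 := fun i => S.measurable_combinedNoise (n := n) k i
  have h2 := fun a => S.measurable_gain (n := n) k a
  refine measurable_pi_lambda _ fun i => ?_
  simp_rw [decision_eq]
  fun_prop

/-! ### The capacity bound -/

lemma _root_.admissibleSymbols_stdComplexGaussianPi (n : ℕ) :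
    AdmissibleSymbols (stdComplexGaussianPi (Fin n)) := by
  refine ⟨inferInstance, fun i => ⟨(finiteMoments_eval_stdComplexGaussianPi i).memLp_two, ?_, ?_⟩⟩
  · refine (integral_comp_eval (μ := fun _ : Fin n => stdComplexGaussian) (i := i)
      (f := fun x : ℂ => x) (by fun_prop)).trans ?_
    have := integral_conj_pow_mul_pow_stdComplexGaussian (p := 0) (q := 1) (by simp) (by simp)
    simpa using this
  · exact (integral_comp_eval (μ := fun _ : Fin n => stdComplexGaussian) (i := i)
      (f := fun x : ℂ => ‖x‖ ^ 2) (by fun_prop)).trans integral_norm_sq_stdComplexGaussian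

/-- Identifies `SINR` with `a²/v` for the test channel. The block length is arbitrary because the
interference power does not depend on it. -/
lemma SINR_eq (n : ℕ) (k : Fin K) :
    S.SINR k = (S.amplitude k * ∑ m, S.γ m k) ^ 2 / (S.interferencePower n k + S.NO k) := by
  rw [SINR, mul_pow, amplitude_sq, ← S.interferencePower_eq_MI n, Complex.ofReal_re]

lemma NO_nonneg (k : Fin K) : 0 ≤ S.NO k := by
  refine Finset.sum_nonneg fun m _ => ?_
  rw [γ, c_eq]
  have h1 := S.δ_nonneg m k
  have h2 := (S.pilotPower_pos m k).le
  positivity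

/-- Gaussian signalling for user `k` in the test-channel bound. The other users need only admissible
laws, as only their second moments matter. -/
lemma ofReal_log_one_add_SINR_le_blockInfo (k : Fin K) {Q : Fin K → Measure (Fin n → ℂ)}
    (hQ : ∀ a, a ≠ k → AdmissibleSymbols (Q a)) :
    ENNReal.ofReal (n * Real.log (1 + S.SINR k)) ≤
      S.blockInfo k (Function.update Q k (stdComplexGaussianPi (Fin n))) := by
  set Q' := Function.update Q k (stdComplexGaussianPi (Fin n)) with hQ'
  have hadm : ∀ a, AdmissibleSymbols (Q' a) := by
    intro a
    by_cases h : a = k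
    · subst h
      simpa [hQ'] using admissibleSymbols_stdComplexGaussianPi n
    · simpa [hQ', h] using hQ a h
  have := fun a => (hadm a).1
  set v := S.interferencePower n k + S.NO k with hv
  -- The test channel needs `v > 0`. If `v = 0`, division by zero makes `SINR` zero and the bound
  -- trivial.
  rcases (add_nonneg (S.interferencePower_nonneg n k) (S.NO_nonneg k)).eq_or_lt with h0 | hpos
  · rw [S.SINR_eq n, ← h0]
    simp
  · have hX : MeasurePreserving
        (fun q : ChannelSample M K N τp n × (Fin K → Fin n → ℂ) => q.2 k)
        ((S.channelLaw n).prod (Measure.pi Q')) (Q' k) :=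
      (measurePreserving_eval Q' k).comp measurePreserving_snd
    have hQk : Q' k = stdComplexGaussianPi (Fin n) := by simp [hQ']
    have key := ofReal_log_le_mutualInfo (P := (S.channelLaw n).prod (Measure.pi Q'))
      hX.measurable (S.measurable_decision k) (hX.map_eq.trans hQk) hpos
      (S.memLp_decision hadm k)
      (fun i => ((hadm k).2 i).1.comp_measurePreserving hX)
      (S.integral_norm_sq_decision hadm k) (S.integral_norm_sq_decision_sub_mean hadm k)
    rw [Fintype.card_fin] at key
    have e : 1 + S.SINR k = ((S.amplitude k * ∑ m, S.γ m k) ^ 2 +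
        (S.interferencePower n k + S.NO k)) / (S.interferencePower n k + S.NO k) := by
      rw [S.SINR_eq n, add_div, div_self hpos.ne', add_comm]
    rw [e]
    exact key

lemma SINR_nonneg (k : Fin K) : 0 ≤ S.SINR k := by
  -- Any block length serves here, in particular the empty block.
  rw [S.SINR_eq 0]
  exact div_nonneg (sq_nonneg _) (add_nonneg (S.interferencePower_nonneg 0 k) (S.NO_nonneg k))

lemma ofReal_logb_le_ergodicCapacity (hn : 1 ≤ n) (k : Fin K) {Q : Fin K → Measure (Fin n → ℂ)}
    (hQ : ∀ a, a ≠ k → AdmissibleSymbols (Q a)) :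
    ENNReal.ofReal (Real.logb 2 (1 + S.SINR k)) ≤ S.ergodicCapacity k Q := by
  have hlog : 0 < Real.log 2 := Real.log_pos (by norm_num)
  have hn0 : (n : ℝ≥0∞) ≠ 0 := by exact_mod_cast (by omega : n ≠ 0)
  rw [ergodicCapacity, ENNReal.le_div_iff_mul_le
    (Or.inl (mul_ne_zero hn0 (ENNReal.ofReal_pos.2 hlog).ne'))
    (Or.inl (ENNReal.mul_ne_top (ENNReal.natCast_ne_top n) ENNReal.ofReal_ne_top))]
  -- The i.i.d. Gaussian block is admissible, so its information is below the supremum. It remains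
  -- to convert nats per block into bits per symbol.
  refine le_trans (le_of_eq ?_) ((S.ofReal_log_one_add_SINR_le_blockInfo k hQ).trans
    (le_iSup₂_of_le (stdComplexGaussianPi (Fin n)) (admissibleSymbols_stdComplexGaussianPi n)
      le_rfl))
  rw [← ENNReal.ofReal_natCast, ← ENNReal.ofReal_mul (Nat.cast_nonneg n),
    ← ENNReal.ofReal_mul (Real.logb_nonneg (by norm_num) (by linarith [S.SINR_nonneg k]))]
  congr 1
  rw [Real.logb]
  field_simp

lemma ofReal_rate_le_ergodicNetThroughput {τc : ℕ} (hτ : τp < τc) {B ν : ℝ} (hB : 0 ≤ B)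
    (hν : 0 ≤ ν) (hn : 1 ≤ n) (k : Fin K) {Q : Fin K → Measure (Fin n → ℂ)}
    (hQ : ∀ a, a ≠ k → AdmissibleSymbols (Q a)) :
    ENNReal.ofReal (S.rate B ν τc k) ≤ S.ergodicNetThroughput B ν τc k Q := by
  have hshare : (τp : ℝ) / τc ≤ 1 := div_le_one_of_le₀ (by exact_mod_cast hτ.le) (Nat.cast_nonneg _)
  rw [rate, ergodicNetThroughput, ENNReal.ofReal_mul
    (mul_nonneg (mul_nonneg hB hν) (sub_nonneg.2 hshare))]
  gcongr
  exact S.ofReal_logb_le_ergodicCapacity hn k hQ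

end RISSystem

theorem theorem1 {M K N τp : ℕ} (S : RISSystem M K N τp) (k : Fin K)
    (τc : ℕ) (hτ : τp < τc) (B ν : ℝ) (hB : 0 ≤ B) (hν0 : 0 ≤ ν) (hν1 : ν ≤ 1)
    (n : ℕ) (hn : 1 ≤ n)
    (Q : Fin K → MeasureTheory.Measure (Fin n → ℂ))
    (hQ : ∀ k', k' ≠ k → AdmissibleSymbols (Q k')) :
    -- the closed-form rate is a lower bound on the ergodic net throughput
    ENNReal.ofReal (S.rate B ν τc k) ≤ S.ergodicNetThroughput B ν τc k Q ∧
    -- its SINR is exactly the use-and-then-forget SINR: mean gain, interference, noise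
    (∀ k', MeasureTheory.MemLp (S.gain (n := n) k k') 2 (S.channelLaw n)) ∧
    (∀ i : Fin n, MeasureTheory.MemLp (S.combinedNoise k i) 2 (S.channelLaw n)) ∧
    S.meanGain n k = ((∑ m, S.γ m k : ℝ) : ℂ) ∧
    ((S.interferencePower n k : ℝ) : ℂ) = S.MI k ∧
    (∀ i : Fin n, S.noisePower k i = S.NO k) :=
  ⟨S.ofReal_rate_le_ergodicNetThroughput hτ hB hν0 hn k hQ,
    fun k' => (S.finiteMoments_gain k k').memLp_two,
    fun i => (S.finiteMoments_combinedNoise k i).memLp_two,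
    S.meanGain_eq n k, S.interferencePower_eq_MI n k, S.noisePower_eq k⟩
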